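/- \textbf{Setting.} Let $\mathbf k=\mathbb R$ or $\mathbb C$, with $\mathbb R\subset\mathbb C=\mathbb R^2$. A marked linkage $\mathcal A$ is a finite graph with a positive length $\ell$ on its edges and finitely many fixed vertices $w_1,\dots,w_s$. Given $Z\in\mathbb C^s$, let $C(\mathcal A)=C(\mathcal A,Z)$ be the set of maps $\phi$ from the vertices to $\mathbb C$ with $|\phi(a)-\phi(b)|^2=\ell[ab]^2$ for all edges $[ab]$ and $\phi(w_r)=z_r$ for all $r$. These real equations define an affine real scheme $\mathfrak C(\mathcal A)$ with set of real points $C(\mathcal A)$. (Optionally, for some degenerate triangles $a,b,c$, $\ell[ac]=\ell[ab]+\ell[bc]$, the equations of the edges $[ab],[bc]$ are replaced in the scheme by $\phi(b)=\frac{\ell[bc]}{\ell[ac]}\phi(a)+\frac{\ell[ab]}{\ell[ac]}\phi(c)$; this does not change $C(\mathcal A)$.) Let $P_1,\dots,P_m$ be input vertices and $Q_1,\dots,Q_n$ output vertices, let $p(\phi)=(\phi(P_1),\dots,\phi(P_m))$, $q(\phi)=(\phi(Q_1),\dots,\phi(Q_n))$, and assume that $p(\phi)\in\mathbf k^m$ for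 all $\phi\in C(\mathcal A)$. Put $Dom(\mathcal A)=p(C(\mathcal A))$. A point of $C(\mathcal A)$ is regular if $p$ is at this point a local isomorphism from the (possibly non-reduced) real analytic space of $\mathfrak C(\mathcal A)$ to $\mathbf k^m$. Let $C^*(\mathcal A)$ be the set of regular points and $Dom^*(\mathcal A)=p(C^*(\mathcal A))$. A continuous map $p:X\to Y$ is a regular ramified covering of its image with group $G$ if $G$ is a finite group of homeomorphisms of $X$, the fibres of $p$ are the $G$-orbits, and $p(X)$ carries the quotient topology. For $F:\mathbf k^m\to\mathbf k^n$ and a nonempty open $U\subset Dom^*(\mathcal A)$, we say that $\mathcal A$, with symmetry group $Sym(\mathcal A)$, is a functional linkage defining $(F,U)$ if: $Dom(\mathcal A)$ has nonempty interior in $\mathbf k^m$; $p$ is a regular ramified covering of $Dom(\mathcal A)$ with group $Sym(\mathcal A)$; every element of $Sym(\mathcal A)$ is induced by an automorphism over $p$ of the real analytic space of $\mathfrak C(\mathcal A)$; nontrivial elements of $Sym(\mathcal A)$ have no fixed points in $p^{-1}(U)$; and $q=F\circ p$ on $C(\mathcal A)$. \textbf{Theorem (2nd functionality theorem).} Let $\mathcal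 A$ be a functional linkage defining $(f,Dom^*(\mathcal A))$, where $f:\mathbf k^m\to\mathbf k^n$, and let $v=P_i$, $w=P_j$ with $i\ne j$. Write $\pi_v(x)=x_i$, $\pi_w(x)=x_j$, and assume that $\{x\in Dom^*(\mathcal A):\pi_v(x)=\pi_w(x)\}\neq\emptyset$. Let $\mathcal L$ be the linkage obtained from $\mathcal A$ by identifying $v$ and $w$, with the same $Z$, with inputs the images of the $P_k$, $k\neq j$, and outputs the images of the $Q_k$. Identify $\mathbf k^{m-1}$ with the hyperplane $H=\{\pi_v=\pi_w\}\subset\mathbf k^m$ by repeating the $i$-th coordinate at the place $j$, and $C(\mathcal L)$ with $\{\phi\in C(\mathcal A):\phi(v)=\phi(w)\}$. Then: \begin{enumerate} \item The input map $p:C(\mathcal L)\to Dom(\mathcal L)$ is a regular ramified covering with a group $Sym(\mathcal L)$, and restriction of symmetries to $C(\mathcal L)$ is an isomorphism $Sym(\mathcal A)\cong Sym(\mathcal L)$. If $\sigma\in Sym(\mathcal A)$ is induced by an automorphism of the scheme $\mathfrak C(\mathcal A)$ over $p$, then its restriction is induced by one of $\mathfrak C(\mathcal L)$. \item This covering is (scheme-theoretically)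 locally analytically trivial over $Dom^*(\mathcal L)$, and $Dom^*(\mathcal L)\supset Dom(\mathcal L)\cap Dom^*(\mathcal A)$. \item The embedding $\mathbf k^{m-1}\to H\subset\mathbf k^m$ restricts to an isomorphism (by polynomial maps) of $Dom(\mathcal L)$ onto $\{x\in Dom(\mathcal A):\pi_v(x)=\pi_w(x)\}$. \item $\mathcal L$, with symmetry group $Sym(\mathcal L)$, is a functional linkage defining $(f|_H,\,Dom(\mathcal L)\cap Dom^*(\mathcal A))$. \end{enumerate} -/

import Mathlib

open Topology

noncomputable section

namespace Linkages

/-! ### Affine schemes over the reals and their real analytic spaces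

A closed subscheme of a finite dimensional real vector space `E` is given by finitely many
polynomial equations `f k = 0` with `k : K`.  Its set of real points is the common zero set. -/

section Scheme

variable {E E' K : Type*} [NormedAddCommGroup E] [NormedSpace ℝ E]
  [NormedAddCommGroup E'] [NormedSpace ℝ E'] [Fintype K]

/-- The germ of `g` at `x` lies in the ideal generated by the equations `f k` in the ring of germs
of real analytic functions at `x`. -/
def AnVanish (f : K → E → ℝ) (x : E) (g : E → ℝ) : Prop :=
  ∃ h : K → E → ℝ, (∀ k, AnalyticAt ℝ (h k) x) ∧ ∀ᶠ y in 𝓝 x, g y = ∑ k, h k y * f k y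

/-- Two maps into a vector space agree, near `x`, on the (possibly non-reduced) real analytic space
defined by the equations `f k`: all their coordinates differ by elements of its ideal at `x`. -/
def AnEq (f : K → E → ℝ) (x : E) (F G : E → E') : Prop :=
  ∀ l : E' →L[ℝ] ℝ, AnVanish f x (fun y => l (F y) - l (G y))

variable (E) in
/-- The algebra of real polynomial functions on `E`. -/
def polyFun : Subalgebra ℝ (E → ℝ) :=
  Algebra.adjoin ℝ (Set.range fun l : E →L[ℝ] ℝ => (l : E → ℝ))

/-- `g` lies in the ideal generated by the equations in the ring of polynomial functions. -/
def PolyVanish (f : K → E → ℝ) (g : E → ℝ) : Prop :=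
  ∃ h : K → E → ℝ, (∀ k, h k ∈ polyFun E) ∧ ∀ y, g y = ∑ k, h k y * f k y

/-- Two polynomial maps into a vector space agree on the scheme defined by the equations. -/
def PolyEq (f : K → E → ℝ) (F G : E → E') : Prop :=
  ∀ l : E' →L[ℝ] ℝ, PolyVanish f (fun y => l (F y) - l (G y))

/-- The family of local analytic maps `F x` (`x` a real point) represents a morphism to itself of
the real analytic space with equations `f k` and set of real points `C`, and this morphism induces
the map `σ` on real points: every `F x` is analytic at `x`, pulls the equations back into the ideal,
and nearby members of the family agree as maps on the analytic space. -/
def IsAnLift (f : K → E → ℝ) (C : Set E) (σ : C → C) (F : C → E → E) : Prop :=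
  ∀ x : C, AnalyticAt ℝ (F x) x ∧ F x x = σ x ∧ (∀ k, AnVanish f x fun y => f k (F x y)) ∧
    ∀ᶠ y : C in 𝓝 x, AnEq f (y : E) (F x) (F y)

/-- `σ` is a scheme-theoretic analytic automorphism of the real analytic space with equations `f k`
and set of real points `C`, over the map `t : E → E'`: it is induced by an automorphism of this
analytic space that commutes with the restriction of `t`. -/
def IsAnAut (f : K → E → ℝ) (C : Set E) (t : E → E') (σ : C ≃ₜ C) : Prop :=
  ∃ F G : C → E → E, IsAnLift f C σ F ∧ IsAnLift f C σ.symm G ∧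
    (∀ x : C, AnEq f (x : E) (fun y => G (σ x) (F x y)) id) ∧
    (∀ x : C, AnEq f (x : E) (fun y => F (σ.symm x) (G x y)) id) ∧
    (∀ x : C, AnEq f (x : E) (fun y => t (F x y)) t)

/-- `σ` is induced by an automorphism, over the map `t : E → E'`, of the affine scheme with
equations `f k`, that is, by a pair of mutually inverse polynomial maps modulo the ideal. -/
def IsPolyAut (f : K → E → ℝ) (C : Set E) (t : E → E') (σ : C ≃ₜ C) : Prop :=
  ∃ F G : E → E, (∀ l : E →L[ℝ] ℝ, (fun y => l (F y)) ∈ polyFun E) ∧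
    (∀ l : E →L[ℝ] ℝ, (fun y => l (G y)) ∈ polyFun E) ∧
    (∀ x : C, F x = σ x) ∧ (∀ x : C, G x = σ.symm x) ∧
    (∀ k, PolyVanish f fun y => f k (F y)) ∧ (∀ k, PolyVanish f fun y => f k (G y)) ∧
    PolyEq f (fun y => G (F y)) id ∧ PolyEq f (fun y => F (G y)) id ∧
    PolyEq f (fun y => t (F y)) t

/-- `x` is a regular (that is, not irregular) point of the morphism from the scheme with equations
`f k` to the vector space `E'` given by the restriction of `t`: this morphism is a local
isomorphism of (non-reduced) real analytic spaces at `x`.  The map `s` is the local inverse. -/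
def IsRegularPoint (f : K → E → ℝ) (t : E → E') (x : E) : Prop :=
  ∃ s : E' → E, AnalyticAt ℝ s (t x) ∧ s (t x) = x ∧ (∀ k, ∀ᶠ z in 𝓝 (t x), f k (s z) = 0) ∧
    (∀ᶠ z in 𝓝 (t x), t (s z) = z) ∧ AnEq f x (fun y => s (t y)) id

/-- Near `z`, the morphism from the scheme with equations `f k` and set of real points `C` to `E'`
given by `t` is a (scheme-theoretic) analytically trivial covering: over an open neighbourhood `U`
of `z`, the preimage is the disjoint union of sheets `s a '' U`, one for every point `a` of the
fibre over `z`, and `t` is on each sheet an isomorphism of (non-reduced) real analytic spaces onto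
`U`, with inverse `s a`. -/
def IsLocallyTrivialAt (f : K → E → ℝ) (C : Set E) (t : E → E') (z : E') : Prop :=
  ∃ (U : Set E') (s : {a : E // a ∈ C ∧ t a = z} → E' → E), IsOpen U ∧ z ∈ U ∧
    (∀ a, AnalyticOnNhd ℝ (s a) U ∧ s a z = a) ∧
    (∀ a, ∀ u ∈ U, s a u ∈ C ∧ t (s a u) = u) ∧
    (∀ x ∈ C, t x ∈ U → ∃! a, s a (t x) = x) ∧
    (∀ a, ∀ u ∈ U, AnEq f (s a u) (fun y => s a (t y)) id)

/-- `F` restricts to an isomorphism from `X` to `Y` in the category of (semi-algebraic) sets and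
restrictions of polynomial maps. -/
def IsPolyIso (X : Set E) (Y : Set E') (F : E → E') : Prop :=
  ∃ G : E' → E, (∀ l : E' →L[ℝ] ℝ, (fun x => l (F x)) ∈ polyFun E) ∧
    (∀ l : E →L[ℝ] ℝ, (fun y => l (G y)) ∈ polyFun E') ∧
    (∀ x ∈ X, F x ∈ Y ∧ G (F x) = x) ∧ ∀ y ∈ Y, G y ∈ X ∧ F (G y) = y

end Scheme

/-- `p : X → Y` is a regular ramified covering of its image with group `G` of covering
transformations: `G` is a finite group of homeomorphisms of `X`, the fibres of `p` are the orbits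
of `G`, and the image of `p` carries the quotient topology. -/
structure IsRegularRamifiedCovering {X Y : Type*} [TopologicalSpace X] [TopologicalSpace Y]
    (p : X → Y) (G : Subgroup (X ≃ₜ X)) : Prop where
  finite : Finite G
  isQuotientMap : IsQuotientMap (Set.rangeFactorization p)
  fiber_iff : ∀ x y, p x = p y ↔ ∃ g ∈ G, g x = y

/-! ### Marked linkages -/

/-- An abstract marked linkage with vertex set `V`, edge set `E` and fixed vertices indexed by `S`.
An edge `e` joins `src e` and `tgt e` (its orientation plays no role) and has length `len e`.
Loops are harmless: a linkage with a loop has no realization.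

The family `D` (which may be empty) lists the degenerate triangles with vertices `A, B, C`, where
`len AC = len AB + len BC`, whose vertex `B` is to be regarded as a hole in the bar `AC`; it
affects only the scheme structure of the configuration space, not its set of points. -/
structure MarkedLinkage (V E S D : Type*) where
  src : E → V
  tgt : E → V
  len : E → ℝ
  len_pos : ∀ e, 0 < len e
  mark : S → V
  triA : D → V
  triB : D → V
  triC : D → V
  edgeAB : D → E
  edgeBC : D → E
  edgeAC : D → E
  endsAB : ∀ d, s(src (edgeAB d), tgt (edgeAB d)) = s(triA d, triB d)
  endsBC : ∀ d, s(src (edgeBC d), tgt (edgeBC d)) = s(triB d, triC d)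
  endsAC : ∀ d, s(src (edgeAC d), tgt (edgeAC d)) = s(triA d, triC d)
  degenerate : ∀ d, len (edgeAC d) = len (edgeAB d) + len (edgeBC d)

namespace MarkedLinkage

variable {V E S D ι κ : Type*}

/-- The relative configuration space `C(A, Z)`: the planar realizations of `A` that send the fixed
vertices to their prescribed images `Z`. -/
def config (A : MarkedLinkage V E S D) (Z : S → ℂ) : Set (V → ℂ) :=
  {φ | (∀ e, ‖φ (A.src e) - φ (A.tgt e)‖ ^ 2 = A.len e ^ 2) ∧ ∀ j, φ (A.mark j) = Z j}

open Classical in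
/-- The equations of the configuration scheme: `|φ(v) - φ(w)|² = len(e)²` for every edge `e = [vw]`
other than the short edges of the listed degenerate triangles (for these, the trivial equation
`0 = 0` is used), `φ(mark j) = Z j` for the fixed vertices, and, for every listed degenerate
triangle, `φ(B) = (|BC| / |AC|) φ(A) + (|AB| / |AC|) φ(C)`.  Equations between complex numbers are
split into real part (`false`) and imaginary part (`true`). -/
def equations (A : MarkedLinkage V E S D) (Z : S → ℂ) :
    E ⊕ (S × Bool) ⊕ (D × Bool) → (V → ℂ) → ℝ
  | Sum.inl e => fun φ =>
      if ∃ d, A.edgeAB d = e ∨ A.edgeBC d = e then 0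
      else ‖φ (A.src e) - φ (A.tgt e)‖ ^ 2 - A.len e ^ 2
  | Sum.inr (Sum.inl (j, b)) => fun φ =>
      (fun z : ℂ => bif b then z.im else z.re) (φ (A.mark j) - Z j)
  | Sum.inr (Sum.inr (d, b)) => fun φ =>
      (fun z : ℂ => bif b then z.im else z.re) (φ (A.triB d) -
        (((A.len (A.edgeBC d) / A.len (A.edgeAC d) : ℝ) : ℂ) * φ (A.triA d) +
          ((A.len (A.edgeAB d) / A.len (A.edgeAC d) : ℝ) : ℂ) * φ (A.triC d)))

/-- The real points of the configuration scheme are the relative realizations. -/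
theorem mem_config_iff [Finite E] (A : MarkedLinkage V E S D) (Z : S → ℂ) (φ : V → ℂ) :
    φ ∈ A.config Z ↔ ∀ k, A.equations Z k φ = 0 := by
  classical
  have swap : ∀ (e : E) (a b : V), s(A.src e, A.tgt e) = s(a, b) →
      ‖φ (A.src e) - φ (A.tgt e)‖ = ‖φ a - φ b‖ := by
    intro e a b h
    rcases Sym2.eq_iff.1 h with ⟨h1, h2⟩ | ⟨h1, h2⟩
    · rw [h1, h2]
    · rw [h1, h2, norm_sub_rev]
  have hnorm : ∀ e, ‖φ (A.src e) - φ (A.tgt e)‖ ^ 2 = A.len e ^ 2 ↔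
      ‖φ (A.src e) - φ (A.tgt e)‖ = A.len e := fun e =>
    pow_left_inj₀ (norm_nonneg _) (A.len_pos e).le two_ne_zero
  constructor
  · rintro ⟨h1, h2⟩ (e | ⟨j, b⟩ | ⟨d, b⟩)
    · simp only [equations]
      split_ifs
      · rfl
      · rw [h1 e, sub_self]
    · simp [equations, h2 j]
    · have hAB := (swap _ _ _ (A.endsAB d)).symm.trans ((hnorm _).1 (h1 (A.edgeAB d)))
      have hBC := (swap _ _ _ (A.endsBC d)).symm.trans ((hnorm _).1 (h1 (A.edgeBC d)))
      have hAC := (swap _ _ _ (A.endsAC d)).symm.trans ((hnorm _).1 (h1 (A.edgeAC d)))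
      have pAB := A.len_pos (A.edgeAB d)
      have pBC := A.len_pos (A.edgeBC d)
      have hdeg := A.degenerate d
      have pAC := A.len_pos (A.edgeAC d)
      have hray : SameRay ℝ (φ (A.triA d) - φ (A.triB d)) (φ (A.triB d) - φ (A.triC d)) := by
        rw [sameRay_iff_norm_add, sub_add_sub_cancel, hAC, hAB, hBC, hdeg]
      have hr := hray.norm_smul_eq
      rw [hAB, hBC] at hr
      simp only [Complex.real_smul] at hr
      have hdegC : (A.len (A.edgeAC d) : ℂ) = A.len (A.edgeAB d) + A.len (A.edgeBC d) := by
        exact_mod_cast hdeg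
      have hne : (A.len (A.edgeAC d) : ℂ) ≠ 0 := by exact_mod_cast pAC.ne'
      have key : φ (A.triB d) -
        (((A.len (A.edgeBC d) / A.len (A.edgeAC d) : ℝ) : ℂ) * φ (A.triA d) +
          ((A.len (A.edgeAB d) / A.len (A.edgeAC d) : ℝ) : ℂ) * φ (A.triC d)) = 0 := by
        push_cast
        field_simp
        rw [hdegC]
        linear_combination hr
      simp only [equations]
      rw [key]
      cases b <;> rfl
  · intro h
    have hlong : ∀ d, φ (A.triB d) =
        ((A.len (A.edgeBC d) / A.len (A.edgeAC d) : ℝ) : ℂ) * φ (A.triA d) +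
          ((A.len (A.edgeAB d) / A.len (A.edgeAC d) : ℝ) : ℂ) * φ (A.triC d) := by
      intro d
      have h0 := h (Sum.inr (Sum.inr (d, false)))
      have h1 := h (Sum.inr (Sum.inr (d, true)))
      simp only [equations, cond_false, cond_true] at h0 h1
      exact sub_eq_zero.1 (Complex.ext h0 h1)
    refine ⟨?_, fun j => ?_⟩
    · have wf : WellFounded fun a b : E => A.len b < A.len a := by
        have : IsTrans E (fun a b : E => A.len b < A.len a) := ⟨fun _ _ _ h1 h2 => h2.trans h1⟩
        have : Std.Irrefl (fun a b : E => A.len b < A.len a) := ⟨fun _ => lt_irrefl _⟩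
        exact Finite.wellFounded_of_trans_of_irrefl _
      intro e
      induction e using wf.induction with
      | _ e ih =>
      by_cases he : ∃ d, A.edgeAB d = e ∨ A.edgeBC d = e
      · obtain ⟨d, hd⟩ := he
        have pAB := A.len_pos (A.edgeAB d)
        have pBC := A.len_pos (A.edgeBC d)
        have hdeg := A.degenerate d
        have pAC := A.len_pos (A.edgeAC d)
        have hdegC : (A.len (A.edgeAC d) : ℂ) = A.len (A.edgeAB d) + A.len (A.edgeBC d) := by
          exact_mod_cast hdeg
        have hne : (A.len (A.edgeAC d) : ℂ) ≠ 0 := by exact_mod_cast pAC.ne'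
        have hAC : ‖φ (A.triA d) - φ (A.triC d)‖ = A.len (A.edgeAC d) := by
          rw [← swap _ _ _ (A.endsAC d), ← hnorm]
          apply ih
          rcases hd with rfl | rfl <;> linarith
        rw [hnorm]
        rcases hd with rfl | rfl
        · rw [swap _ _ _ (A.endsAB d)]
          have : φ (A.triA d) - φ (A.triB d) =
              ((A.len (A.edgeAB d) / A.len (A.edgeAC d) : ℝ) : ℂ) *
                (φ (A.triA d) - φ (A.triC d)) := by
            rw [hlong d]
            push_cast
            field_simp
            rw [hdegC]
            ring
          rw [this, norm_mul, hAC, Complex.norm_real, Real.norm_of_nonneg (by positivity)]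
          field_simp
        · rw [swap _ _ _ (A.endsBC d)]
          have : φ (A.triB d) - φ (A.triC d) =
              ((A.len (A.edgeBC d) / A.len (A.edgeAC d) : ℝ) : ℂ) *
                (φ (A.triA d) - φ (A.triC d)) := by
            rw [hlong d]
            push_cast
            field_simp
            rw [hdegC]
            ring
          rw [this, norm_mul, hAC, Complex.norm_real, Real.norm_of_nonneg (by positivity)]
          field_simp
      · have h0 := h (Sum.inl e)
        simp only [equations, if_neg he] at h0
        exact sub_eq_zero.1 h0
    · have h0 := h (Sum.inr (Sum.inl (j, false)))
      have h1 := h (Sum.inr (Sum.inl (j, true)))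
      simp only [equations, cond_false, cond_true] at h0 h1
      exact sub_eq_zero.1 (Complex.ext h0 h1)

/-! ### Functional linkages

Throughout, `P : ι → V` are the input vertices and `Q : κ → V` the output vertices. The field `𝕜`
is `ℝ` or `ℂ`, regarded as a part of the plane `ℂ` through `RCLike.map 𝕜 ℂ`. -/

/-- The positions of the input vertices in the plane. -/
def inputPos (P : ι → V) (φ : V → ℂ) : ι → ℂ := fun i => φ (P i)

variable (𝕜 : Type*) [RCLike 𝕜]

/-- The input map, with values in `𝕜^ι`; for `𝕜 = ℝ` it takes real parts, and it is
used only where the inputs are known to be real. -/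
def inputMap (P : ι → V) (φ : V → ℂ) : ι → 𝕜 := fun i => RCLike.map ℂ 𝕜 (φ (P i))

/-- The domain: the image of the input map. -/
def dom (A : MarkedLinkage V E S D) (Z : S → ℂ) (P : ι → V) : Set (ι → 𝕜) :=
  inputMap 𝕜 P '' A.config Z

variable [Fintype V] [Fintype E] [Fintype S] [Fintype D] [Fintype ι]

/-- The set `C*` of regular points of the input morphism. -/
def regularSet (A : MarkedLinkage V E S D) (Z : S → ℂ) (P : ι → V) : Set (V → ℂ) :=
  {φ ∈ A.config Z | IsRegularPoint (A.equations Z) (inputMap 𝕜 P) φ}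

/-- The set `Dom*`: the image of the set of regular points. -/
def domStar (A : MarkedLinkage V E S D) (Z : S → ℂ) (P : ι → V) : Set (ι → 𝕜) :=
  inputMap 𝕜 P '' A.regularSet 𝕜 Z P

variable {𝕜}

/-- `(A, Z)` with inputs `P`, outputs `Q` and symmetry group `Sym` is a `𝕜`-functional linkage for
the map `F`, and it defines `F` on the open set `U ⊆ Dom*`. -/
structure IsFunctional (A : MarkedLinkage V E S D) (Z : S → ℂ) (P : ι → V) (Q : κ → V)
    (F : (ι → 𝕜) → κ → 𝕜) (U : Set (ι → 𝕜)) (Sym : Subgroup (A.config Z ≃ₜ A.config Z)) :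
    Prop where
  /-- the inputs take values in `𝕜` -/
  input_mem : ∀ φ ∈ A.config Z, ∀ i, RCLike.map 𝕜 ℂ (inputMap 𝕜 P φ i) = φ (P i)
  /-- the image of the input map is a domain -/
  domain : (interior (A.dom 𝕜 Z P)).Nonempty
  /-- the input map is a regular ramified covering with group `Sym` -/
  covering : IsRegularRamifiedCovering (fun φ : A.config Z => inputMap 𝕜 P (φ : V → ℂ)) Sym
  /-- the symmetries are scheme-theoretic automorphisms over the input morphism -/
  isAnAut : ∀ σ ∈ Sym, IsAnAut (A.equations Z) (A.config Z) (inputPos P) σ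
  isOpen : IsOpen U
  nonempty : U.Nonempty
  subset_domStar : U ⊆ A.domStar 𝕜 Z P
  /-- the covering is unramified over `U`: nontrivial symmetries have no fixed points there -/
  unramified : ∀ σ ∈ Sym, ∀ φ : A.config Z, inputMap 𝕜 P (φ : V → ℂ) ∈ U → σ φ = φ → σ = 1
  /-- the outputs are given by applying `F` to the inputs -/
  output : ∀ φ ∈ A.config Z, ∀ k, φ (Q k) = RCLike.map 𝕜 ℂ (F (inputMap 𝕜 P φ) k)

end MarkedLinkage

/-! ### Identification of two vertices -/

/-- The vertex set obtained from `V` by identifying `v` and `w`. -/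
def Glued {V : Type*} (v w : V) : Type _ := Quot fun a b : V => a = v ∧ b = w

instance {V : Type*} [Finite V] (v w : V) : Finite (Glued v w) :=
  inferInstanceAs (Finite (Quot _))

instance {V : Type*} [Fintype V] (v w : V) : Fintype (Glued v w) := Fintype.ofFinite _

/-- The projection to the glued vertex set. -/
def Glued.mk {V : Type*} (v w : V) (u : V) : Glued v w := Quot.mk _ u

namespace MarkedLinkage

variable {V E S D : Type*}

/-- The self-fiber sum of `A` in which the vertices `v` and `w` are identified. -/
def glue (A : MarkedLinkage V E S D) (v w : V) : MarkedLinkage (Glued v w) E S D where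
  src e := Glued.mk v w (A.src e)
  tgt e := Glued.mk v w (A.tgt e)
  len := A.len
  len_pos := A.len_pos
  mark j := Glued.mk v w (A.mark j)
  triA d := Glued.mk v w (A.triA d)
  triB d := Glued.mk v w (A.triB d)
  triC d := Glued.mk v w (A.triC d)
  edgeAB := A.edgeAB
  edgeBC := A.edgeBC
  edgeAC := A.edgeAC
  endsAB d := congrArg (Sym2.map (Glued.mk v w)) (A.endsAB d)
  endsBC d := congrArg (Sym2.map (Glued.mk v w)) (A.endsBC d)
  endsAC d := congrArg (Sym2.map (Glued.mk v w)) (A.endsAC d)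
  degenerate := A.degenerate

/-- A realization of the glued linkage, viewed as a realization of `A`. -/
def unglue (A : MarkedLinkage V E S D) (Z : S → ℂ) (v w : V) (φ : (A.glue v w).config Z) :
    A.config Z :=
  ⟨fun u => φ.1 (Glued.mk v w u), φ.2.1, φ.2.2⟩

end MarkedLinkage

/-- The linear parametrization of the hyperplane `x i = x j` of `𝕜^ι` by the coordinates
other than the `j`-th: the `j`-th coordinate is set to be equal to the `i`-th. -/
def hyperplaneParam {ι 𝕜 : Type*} [DecidableEq ι] {i j : ι} (hij : i ≠ j) (y : {k : ι // k ≠ j} → 𝕜) : ι → 𝕜 :=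
  fun k => if h : k = j then y ⟨i, hij⟩ else y ⟨k, h⟩

end Linkages

end

/-! The scheme of `L` is a linear slice of the scheme of `A`: its equations are those of `A`
restricted to the subspace `φ(v) = φ(w)`. Since `v` and `w` are inputs, this subspace is cut out by
a condition on the inputs alone. Symmetries preserve the inputs, so they preserve the slice, and a
fibre of the input map that meets the slice lies entirely in it. Fibres, orbits, quotient topology,
domain and output map are therefore simply restricted.

The schemes may be non-reduced, so restricting a symmetry as an automorphism requires more than
restricting a map of points. A local lift `F` of a symmetry need not map the slice to the slice, but
the defect of `F` from the slice is a linear function of its inputs, hence zero modulo the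
restricted ideal (`LinearSlice.anEq_incl_retr`). `F` may thus be replaced by its retraction to the
slice. This replacement survives composition with analytic maps because analytic maps respect
congruence modulo the ideal (`AnEq.comp_left`), which is Hadamard's lemma.

Restriction of symmetries is injective because the hyperplane meets `Dom*(A)`, where a nontrivial
symmetry has no fixed points. A local inverse of the input map of `A` restricts to one for `L`,
which gives the inclusion of regular values. Finally, automorphisms carry regular points to regular
points and act transitively on fibres, so one regular point makes its whole fibre regular. The local
inverses at the finitely many points of the fibre are then the sheets of a trivial covering
(`isLocallyTrivialAt_of_isRegularPoint`). -/

noncomputable section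

namespace Linkages

/-! ### Hadamard's lemma for real analytic maps -/

section Hadamard

variable {E F : Type*} [NormedAddCommGroup E] [NormedSpace ℝ E]
  [NormedAddCommGroup F] [NormedSpace ℝ F]

/-- The divided difference of a homogeneous polynomial: the multilinear map whose value at
`((z, w), …, (z, w))` and `z - w` is `f (z, …, z) - f (w, …, w)`. -/
def dividedDifference {n : ℕ} (f : ContinuousMultilinearMap ℝ (fun _ : Fin (n + 1) => E) F) :
    ContinuousMultilinearMap ℝ (fun _ : Fin n => E × E) (E →L[ℝ] F) :=
  ∑ p : Fin (n + 1), (f.curryMid p).flipMultilinear.compContinuousLinearMap fun i : Fin n =>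
    if i.castSucc < p then ContinuousLinearMap.fst ℝ E E else ContinuousLinearMap.snd ℝ E E

/-- A telescoping sum over the hybrid tuples `v k`, with `z` in the first `k` places and `w` in the
rest. Consecutive tuples differ only at place `p`, so by multilinearity their difference is the
value of `f` with `z - w` inserted there. -/
theorem dividedDifference_apply {n : ℕ}
    (f : ContinuousMultilinearMap ℝ (fun _ : Fin (n + 1) => E) F) (z w : E) :
    dividedDifference f (fun _ => (z, w)) (z - w) = f (fun _ => z) - f fun _ => w := by
  let v : ℕ → Fin (n + 1) → E := fun k j => if (j : ℕ) < k then z else w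
  have hv : ∀ p : Fin (n + 1),
      p.insertNth (z - w) (fun i : Fin n => if i.castSucc < p then z else w) =
        Function.update (v p) p (z - w) := by
    intro p
    rw [Fin.insertNth_eq_iff]
    refine ⟨by simp, ?_⟩
    funext i
    simp only [Fin.removeNth, Function.update_of_ne (Fin.succAbove_ne p i), v]
    refine if_congr ?_ rfl rfl
    rw [← Fin.lt_def, Fin.succAbove_lt_iff_castSucc_lt]
  have h1 : ∀ p : Fin (n + 1), v (p + 1) = Function.update (v p) p z := by
    intro p; funext j
    by_cases hj : j = p
    · subst hj; simp [v]
    · have : (j : ℕ) ≠ p := fun h => hj (Fin.ext h)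
      simp only [v, Function.update_of_ne hj]
      exact if_congr (by omega) rfl rfl
  have h2 : ∀ p : Fin (n + 1), v p = Function.update (v p) p w := by
    intro p; simp [v]
  have key : dividedDifference f (fun _ => (z, w)) (z - w) =
      ∑ p : Fin (n + 1), (f (v (p + 1)) - f (v p)) := by
    simp only [dividedDifference, sum_apply]
    refine Finset.sum_congr rfl fun p _ => ?_
    rw [h1 p, h2 p, Function.update_idem, ← f.map_update_sub, ← hv]
    simp only [ContinuousMultilinearMap.compContinuousLinearMap_apply,
      ContinuousLinearMap.flipMultilinear_apply_apply, ContinuousMultilinearMap.curryMid_apply]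
    congr 2
    funext i
    split_ifs <;> rfl
  rw [key, Fin.sum_univ_eq_sum_range (fun k => f (v (k + 1)) - f (v k)), Finset.sum_range_sub (fun k => f (v k))]
  congr 2
  funext j
  simp [v, j.is_lt]

/-- Each of the `n + 1` telescoping terms has norm at most `‖f‖`. The linear growth of this factor
keeps the radius of convergence of the divided series positive. -/
theorem norm_dividedDifference_le {n : ℕ}
    (f : ContinuousMultilinearMap ℝ (fun _ : Fin (n + 1) => E) F) :
    ‖dividedDifference f‖ ≤ (n + 1) * ‖f‖ := by
  have hsum : ((n : ℝ) + 1) * ‖f‖ = ∑ _p : Fin (n + 1), ‖f‖ := by simp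
  rw [hsum, dividedDifference]
  refine (norm_sum_le (E := ContinuousMultilinearMap ℝ (fun _ : Fin n => E × E) (E →L[ℝ] F)) _
    _).trans (Finset.sum_le_sum fun p _ => ?_)
  refine ContinuousMultilinearMap.opNorm_le_bound (norm_nonneg _) fun m => ?_
  refine ContinuousLinearMap.opNorm_le_bound _ (by positivity) fun x => ?_
  simp only [ContinuousMultilinearMap.compContinuousLinearMap_apply,
      ContinuousLinearMap.flipMultilinear_apply_apply]
  refine (ContinuousMultilinearMap.le_opNorm _ _).trans ?_
  have h1 : ‖f.curryMid p x‖ ≤ ‖f‖ * ‖x‖ := by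
    simpa using (f.curryMid p).le_opNorm x
  have h2 : ∏ i : Fin n, ‖(if i.castSucc < p then ContinuousLinearMap.fst ℝ E E
      else ContinuousLinearMap.snd ℝ E E) (m i)‖ ≤ ∏ i, ‖m i‖ := by
    refine Finset.prod_le_prod (fun _ _ => norm_nonneg _) fun i _ => ?_
    split_ifs
    · exact norm_fst_le _
    · exact norm_snd_le _
  calc _ ≤ (‖f‖ * ‖x‖) * ∏ i, ‖m i‖ := by gcongr
    _ = _ := by ring

/-- **Hadamard's lemma** for analytic functions. -/
theorem exists_analyticAt_sub_eq [CompleteSpace F] {g : E → F} {x : E} (hg : AnalyticAt ℝ g x) :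
    ∃ H : E × E → E →L[ℝ] F, AnalyticAt ℝ H (x, x) ∧
      ∀ᶠ y : E × E in 𝓝 (x, x), g y.1 - g y.2 = H y (y.1 - y.2) := by
  obtain ⟨P, R, hP⟩ := hg
  let q : FormalMultilinearSeries ℝ (E × E) (E →L[ℝ] F) := fun n => dividedDifference (P (n + 1))
  obtain ⟨a, ha0, haR⟩ : ∃ a : NNReal, 0 < a ∧ (a : ENNReal) < P.radius := by
    obtain ⟨a, h1, h2⟩ := ENNReal.lt_iff_exists_nnreal_btwn.1 (hP.r_pos.trans_le hP.r_le)
    exact ⟨a, by exact_mod_cast h1, h2⟩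
  obtain ⟨C, hC0, hC⟩ := P.norm_mul_pow_le_of_lt_radius haR
  have ha0' : (0 : ℝ) < a := by exact_mod_cast ha0
  -- Halving the radius absorbs the factor `n + 1 ≤ 2 ^ n`. The bound is `C / a` because `q n` is
  -- built from the coefficient of degree `n + 1`.
  have hq : ((a / 2 : NNReal) : ENNReal) ≤ q.radius := by
    refine q.le_radius_of_bound (C / a) fun n => ?_
    have h2 : ((n : ℝ) + 1) ≤ 2 ^ n := by exact_mod_cast Nat.lt_two_pow_self
    have h3 := hC (n + 1)
    have h4 := norm_dividedDifference_le (P (n + 1))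
    rw [le_div_iff₀ ha0']
    calc ‖q n‖ * ((a / 2 : NNReal) : ℝ) ^ n * a
        ≤ ((n + 1) * ‖P (n + 1)‖) * ((a / 2 : NNReal) : ℝ) ^ n * a := by gcongr
      _ ≤ (2 ^ n * ‖P (n + 1)‖) * ((a / 2 : NNReal) : ℝ) ^ n * a := by gcongr
      _ = ‖P (n + 1)‖ * a ^ (n + 1) := by
        push_cast; rw [div_pow]; field_simp; ring
      _ ≤ C := h3
  have hqpos : 0 < q.radius := lt_of_lt_of_le (by exact_mod_cast half_pos ha0) hq
  have hs := q.hasFPowerSeriesOnBall hqpos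
  refine ⟨fun y => q.sum (y - (x, x)), ?_, ?_⟩
  · refine AnalyticAt.comp (g := q.sum) ?_ (analyticAt_id.sub analyticAt_const)
    simpa using hs.analyticAt
  · have e1 : ∀ᶠ y : E × E in 𝓝 (x, x), y.1 - x ∈ Metric.eball (0 : E) R := by
      have : Filter.Tendsto (fun y : E × E => y.1 - x) (𝓝 (x, x)) (𝓝 0) := by
        have h : Continuous fun y : E × E => y.1 - x := by fun_prop
        simpa using h.tendsto (x, x)
      exact this (Metric.eball_mem_nhds _ hP.r_pos)
    have e2 : ∀ᶠ y : E × E in 𝓝 (x, x), y.2 - x ∈ Metric.eball (0 : E) R := by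
      have : Filter.Tendsto (fun y : E × E => y.2 - x) (𝓝 (x, x)) (𝓝 0) := by
        have h : Continuous fun y : E × E => y.2 - x := by fun_prop
        simpa using h.tendsto (x, x)
      exact this (Metric.eball_mem_nhds _ hP.r_pos)
    have e3 : ∀ᶠ y : E × E in 𝓝 (x, x), y - (x, x) ∈ Metric.eball (0 : E × E) q.radius := by
      have : Filter.Tendsto (fun y : E × E => y - (x, x)) (𝓝 (x, x)) (𝓝 0) := by
        have h : Continuous fun y : E × E => y - (x, x) := by fun_prop
        simpa using h.tendsto (x, x)
      exact this (Metric.eball_mem_nhds _ hqpos)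
    filter_upwards [e1, e2, e3] with y h1 h2 h3
    have s1 := hP.hasSum h1
    have s2 := hP.hasSum h2
    have s3 := hs.hasSum h3
    simp only [add_sub_cancel, zero_add] at s1 s2 s3
    have s12 := s1.sub s2
    -- The constant terms cancel in the difference, so the series may start in degree one, matching
    -- the shift in `q`.
    rw [← hasSum_nat_add_iff' 1] at s12
    have s3' := s3.mapL (ContinuousLinearMap.apply ℝ F (y.1 - y.2))
    simp only [Finset.sum_range_one] at s12
    have hz : (P 0 fun _ => y.1 - x) - (P 0 fun _ => y.2 - x) = 0 := by
      rw [sub_eq_zero]; congr 1; funext i; exact i.elim0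
    rw [hz, sub_zero] at s12
    have h4 : ∀ n, (P (n + 1) fun _ => y.1 - x) - (P (n + 1) fun _ => y.2 - x) =
        q n (fun _ => y - (x, x)) (y.1 - y.2) := by
      intro n
      rw [← sub_sub_sub_cancel_right y.1 y.2 x]
      exact (dividedDifference_apply _ _ _).symm
    simp only [h4] at s12
    exact s12.unique s3'

end Hadamard

/-! ### Congruence modulo the ideal of a scheme, analytic and polynomial -/

section Ideal

variable {E E' E'' K K' : Type*} [NormedAddCommGroup E] [NormedSpace ℝ E]
  [NormedAddCommGroup E'] [NormedSpace ℝ E'] [NormedAddCommGroup E''] [NormedSpace ℝ E'']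
  [Fintype K] [Fintype K'] {f : K → E → ℝ} {f' : K' → E' → ℝ} {x : E}

namespace AnVanish

theorem zero : AnVanish f x fun _ => 0 :=
  ⟨fun _ => 0, fun _ => analyticAt_const, by simp⟩

theorem add {g g' : E → ℝ} (hg : AnVanish f x g) (hg' : AnVanish f x g') :
    AnVanish f x (fun y => g y + g' y) := by
  obtain ⟨h, h1, h2⟩ := hg
  obtain ⟨h', h1', h2'⟩ := hg'
  refine ⟨fun k => h k + h' k, fun k => (h1 k).add (h1' k), ?_⟩
  filter_upwards [h2, h2'] with y e e'
  simp [e, e', add_mul, Finset.sum_add_distrib]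

theorem mul_left {a g : E → ℝ} (ha : AnalyticAt ℝ a x) (hg : AnVanish f x g) :
    AnVanish f x (fun y => a y * g y) := by
  obtain ⟨h, h1, h2⟩ := hg
  refine ⟨fun k => a * h k, fun k => ha.mul (h1 k), ?_⟩
  filter_upwards [h2] with y e
  simp [e, Finset.mul_sum, mul_assoc]

theorem neg {g : E → ℝ} (hg : AnVanish f x g) : AnVanish f x (fun y => -g y) := by
  simpa using hg.mul_left (a := fun _ => -1) analyticAt_const

theorem sum {ι : Type*} (s : Finset ι) {g : ι → E → ℝ} (hg : ∀ i ∈ s, AnVanish f x (g i)) :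
    AnVanish f x (fun y => ∑ i ∈ s, g i y) := by
  classical
  induction s using Finset.induction_on with
  | empty => simpa using zero
  | insert i s hi ih =>
    simp only [Finset.sum_insert hi]
    exact (hg i (Finset.mem_insert_self _ _)).add
      (ih fun j hj => hg j (Finset.mem_insert_of_mem hj))

theorem congr {g g' : E → ℝ} (hg : AnVanish f x g) (h : g =ᶠ[𝓝 x] g') : AnVanish f x g' := by
  obtain ⟨a, h1, h2⟩ := hg
  refine ⟨a, h1, ?_⟩
  filter_upwards [h2, h] with y e e'
  rw [← e', e]

/-- The hypothesis `hf` makes `Φ` a morphism of analytic spaces near `x`: it pulls the generators of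
the ideal back into the ideal, hence everything. -/
theorem comp {Φ : E → E'} {g : E' → ℝ} (hg : AnVanish f' (Φ x) g) (hΦ : AnalyticAt ℝ Φ x)
    (hf : ∀ k, AnVanish f x fun y => f' k (Φ y)) : AnVanish f x fun y => g (Φ y) := by
  obtain ⟨a, h1, h2⟩ := hg
  refine (sum Finset.univ fun k _ => (hf k).mul_left ((h1 k).comp hΦ)).congr ?_
  filter_upwards [hΦ.continuousAt.eventually h2] with y e
  exact e.symm

/-- The same coefficients serve at all nearby points. -/
theorem eventually {g : E → ℝ} (hg : AnVanish f x g) : ∀ᶠ y in 𝓝 x, AnVanish f y g := by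
  obtain ⟨a, h1, h2⟩ := hg
  filter_upwards [Filter.eventually_all.2 fun k => (h1 k).eventually_analyticAt,
    h2.eventually_nhds] with y e e'
  exact ⟨a, e, e'⟩

theorem eq_zero {g : E → ℝ} (hg : AnVanish f x g) (hx : ∀ k, f k x = 0) : g x = 0 := by
  obtain ⟨a, -, h2⟩ := hg
  simp [h2.self_of_nhds, hx]

theorem eventually_comp_eq_zero {g : E → ℝ} {X : Type*} [TopologicalSpace X]
    (hg : AnVanish f x g) {s : X → E} {z : X}
    (hs : ContinuousAt s z) (hz : s z = x) (hf : ∀ k, ∀ᶠ u in 𝓝 z, f k (s u) = 0) :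
    ∀ᶠ u in 𝓝 z, g (s u) = 0 := by
  subst hz
  obtain ⟨a, -, h2⟩ := hg
  filter_upwards [hs.eventually h2, Filter.eventually_all.2 hf] with u e e'
  simp [e, e']

end AnVanish

namespace AnEq

theorem refl (F : E → E') : AnEq f x F F := fun l => by
  simpa using AnVanish.zero (f := f) (x := x)

theorem symm {F G : E → E'} (h : AnEq f x F G) : AnEq f x G F := fun l => by
  simpa using (h l).neg

theorem trans {F G H : E → E'} (h : AnEq f x F G) (h' : AnEq f x G H) : AnEq f x F H := fun l => by
  simpa using (h l).add (h' l)

theorem clm_comp (L : E' →L[ℝ] E'') {F G : E → E'} (h : AnEq f x F G) :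
    AnEq f x (fun y => L (F y)) fun y => L (G y) := fun l => h (l.comp L)

theorem add {F G F' G' : E → E'} (h : AnEq f x F G) (h' : AnEq f x F' G') :
    AnEq f x (fun y => F y + F' y) fun y => G y + G' y := fun l => by
  simpa [add_sub_add_comm] using (h l).add (h' l)

/-- Pull-back along a morphism of analytic spaces. -/
theorem comp_right {Φ : E → E'} {F G : E' → E''} (h : AnEq f' (Φ x) F G) (hΦ : AnalyticAt ℝ Φ x)
    (hf : ∀ k, AnVanish f x fun y => f' k (Φ y)) :
    AnEq f x (fun y => F (Φ y)) fun y => G (Φ y) := fun l => (h l).comp hΦ hf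

variable [FiniteDimensional ℝ E']

/-- It suffices to compare coordinates. -/
theorem of_basis {F G : E → E'}
    (h : ∀ i, AnVanish f x fun y =>
      (Module.finBasis ℝ E').coord i (F y) - (Module.finBasis ℝ E').coord i (G y)) :
    AnEq f x F G := by
  intro l
  refine (AnVanish.sum Finset.univ fun i _ => (h i).mul_left
    (a := fun _ => l (Module.finBasis ℝ E' i)) analyticAt_const).congr (.of_forall fun y => ?_)
  have e : ∀ v : E', l v = ∑ i, l (Module.finBasis ℝ E' i) * (Module.finBasis ℝ E').coord i v := by
    intro v
    calc l v = l (∑ i, (Module.finBasis ℝ E').repr v i • Module.finBasis ℝ E' i) := by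
          rw [(Module.finBasis ℝ E').sum_repr v]
      _ = _ := by simp only [map_sum, map_smul, smul_eq_mul, Module.Basis.coord_apply, mul_comm]
  simp only [e (F y), e (G y), ← Finset.sum_sub_distrib, mul_sub]

theorem coord {F G : E → E'} (h : AnEq f x F G) (i : Fin (Module.finrank ℝ E')) :
    AnVanish f x fun y =>
      (Module.finBasis ℝ E').coord i (F y) - (Module.finBasis ℝ E').coord i (G y) :=
  h (LinearMap.toContinuousLinearMap ((Module.finBasis ℝ E').coord i))

/-- A common neighbourhood for all functionals exists because finitely many coordinates suffice. -/
theorem eventually {F G : E → E'} (h : AnEq f x F G) : ∀ᶠ y in 𝓝 x, AnEq f y F G := by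
  filter_upwards [Filter.eventually_all.2 fun i => (h.coord i).eventually] with y e
  exact of_basis e

theorem eq_of_coord {v w : E'}
    (h : ∀ i, (Module.finBasis ℝ E').coord i v - (Module.finBasis ℝ E').coord i w = 0) : v = w :=
  (Module.finBasis ℝ E').ext_elem fun i => sub_eq_zero.1 (h i)

theorem eventually_comp_eq {F G : E → E'} {X : Type*} [TopologicalSpace X]
    (h : AnEq f x F G) {s : X → E} {z : X}
    (hs : ContinuousAt s z) (hz : s z = x) (hf : ∀ k, ∀ᶠ u in 𝓝 z, f k (s u) = 0) :
    ∀ᶠ u in 𝓝 z, F (s u) = G (s u) := by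
  filter_upwards [Filter.eventually_all.2 fun i =>
    (h.coord i).eventually_comp_eq_zero hs hz hf] with u e
  exact eq_of_coord e

theorem apply_eq {F G : E → E'} (h : AnEq f x F G) (hx : ∀ k, f k x = 0) : F x = G x :=
  eq_of_coord fun i => (h.coord i).eq_zero hx

/-- Analytic maps send maps that agree on an analytic space to maps that agree on it. -/
theorem comp_left {F G : E → E'} {g : E' → E''} (h : AnEq f x F G) (hF : AnalyticAt ℝ F x)
    (hG : AnalyticAt ℝ G x) (hx : F x = G x) (hg : AnalyticAt ℝ g (F x)) :
    AnEq f x (fun y => g (F y)) fun y => g (G y) := by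
  intro l
  -- Hadamard's lemma writes the difference of the values as a combination, with analytic
  -- coefficients, of the coordinates of `F - G`, which lie in the ideal.
  obtain ⟨H, h1, h2⟩ := exists_analyticAt_sub_eq ((l.analyticAt _).comp hg)
  have hFG : AnalyticAt ℝ (fun y => (F y, G y)) x := hF.prod hG
  have hFGx : (F x, G x) = (F x, F x) := by rw [hx]
  have hH : AnalyticAt ℝ (fun y => H (F y, G y)) x :=
    AnalyticAt.fun_comp (by rw [hFGx]; exact h1) hFG
  refine (AnVanish.sum Finset.univ fun i _ => (h.coord i).mul_left
    (a := fun y => H (F y, G y) (Module.finBasis ℝ E' i))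
    (((ContinuousLinearMap.apply ℝ ℝ (Module.finBasis ℝ E' i)).analyticAt _).comp hH)).congr ?_
  rw [← hFGx] at h2
  filter_upwards [hFG.continuousAt.eventually h2] with y e
  simp only [Function.comp] at e
  rw [e]
  calc _ = H (F y, G y) (∑ i, (Module.finBasis ℝ E').repr (F y - G y) i •
          Module.finBasis ℝ E' i) := by
        simp only [map_sum, map_smul, smul_eq_mul, map_sub, Module.Basis.coord_apply, mul_comm,
          Finsupp.sub_apply]
    _ = _ := by rw [(Module.finBasis ℝ E').sum_repr]

end AnEq

theorem analyticAt_of_mem_polyFun {g : E → ℝ} (hg : g ∈ polyFun E) (x : E) : AnalyticAt ℝ g x := by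
  induction hg using Algebra.adjoin_induction with
  | mem g hg =>
    obtain ⟨l, rfl⟩ := hg
    exact l.analyticAt x
  | algebraMap r => exact analyticAt_const
  | add g g' _ _ h h' => exact h.add h'
  | mul g g' _ _ h h' => exact h.mul h'

theorem clm_mem_polyFun (l : E →L[ℝ] ℝ) : (fun y => l y) ∈ polyFun E :=
  Algebra.subset_adjoin ⟨l, rfl⟩

theorem const_mem_polyFun (r : ℝ) : (fun _ => r) ∈ polyFun E :=
  (polyFun E).algebraMap_mem r

theorem comp_mem_polyFun {g : E' → ℝ} (hg : g ∈ polyFun E') {F : E → E'}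
    (hF : ∀ l : E' →L[ℝ] ℝ, (fun y => l (F y)) ∈ polyFun E) : (fun y => g (F y)) ∈ polyFun E := by
  induction hg using Algebra.adjoin_induction with
  | mem g hg =>
    obtain ⟨l, rfl⟩ := hg
    exact hF l
  | algebraMap r => exact const_mem_polyFun r
  | add g g' _ _ h h' => exact add_mem h h'
  | mul g g' _ _ h h' => exact mul_mem h h'

namespace PolyVanish

theorem zero : PolyVanish f fun _ => 0 :=
  ⟨fun _ => 0, fun _ => zero_mem _, by simp⟩

theorem add {g g' : E → ℝ} (hg : PolyVanish f g) (hg' : PolyVanish f g') :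
    PolyVanish f (fun y => g y + g' y) := by
  obtain ⟨h, h1, h2⟩ := hg
  obtain ⟨h', h1', h2'⟩ := hg'
  exact ⟨fun k => h k + h' k, fun k => add_mem (h1 k) (h1' k), fun y => by
    simp [h2, h2', add_mul, Finset.sum_add_distrib]⟩

theorem mul_left {a g : E → ℝ} (ha : a ∈ polyFun E) (hg : PolyVanish f g) :
    PolyVanish f (fun y => a y * g y) := by
  obtain ⟨h, h1, h2⟩ := hg
  exact ⟨fun k => a * h k, fun k => mul_mem ha (h1 k), fun y => by
    simp [h2, Finset.mul_sum, mul_assoc]⟩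

theorem neg {g : E → ℝ} (hg : PolyVanish f g) : PolyVanish f (fun y => -g y) := by
  simpa using hg.mul_left (const_mem_polyFun (-1))

theorem sum {ι : Type*} (s : Finset ι) {g : ι → E → ℝ} (hg : ∀ i ∈ s, PolyVanish f (g i)) :
    PolyVanish f (fun y => ∑ i ∈ s, g i y) := by
  classical
  induction s using Finset.induction_on with
  | empty => simpa using zero
  | insert i s hi ih =>
    simp only [Finset.sum_insert hi]
    exact (hg i (Finset.mem_insert_self _ _)).add
      (ih fun j hj => hg j (Finset.mem_insert_of_mem hj))

theorem comp {Φ : E → E'} {g : E' → ℝ} (hg : PolyVanish f' g)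
    (hΦ : ∀ l : E' →L[ℝ] ℝ, (fun y => l (Φ y)) ∈ polyFun E)
    (hf : ∀ k, PolyVanish f fun y => f' k (Φ y)) : PolyVanish f fun y => g (Φ y) := by
  obtain ⟨a, h1, h2⟩ := hg
  simp only [h2]
  exact sum Finset.univ fun k _ => (hf k).mul_left (comp_mem_polyFun (h1 k) hΦ)

end PolyVanish

namespace PolyEq

theorem refl (F : E → E') : PolyEq f F F := fun l => by
  simpa using PolyVanish.zero (f := f)

theorem symm {F G : E → E'} (h : PolyEq f F G) : PolyEq f G F := fun l => by
  simpa using (h l).neg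

theorem trans {F G H : E → E'} (h : PolyEq f F G) (h' : PolyEq f G H) : PolyEq f F H := fun l => by
  simpa using (h l).add (h' l)

theorem clm_comp (L : E' →L[ℝ] E'') {F G : E → E'} (h : PolyEq f F G) :
    PolyEq f (fun y => L (F y)) fun y => L (G y) := fun l => h (l.comp L)

theorem add {F G F' G' : E → E'} (h : PolyEq f F G) (h' : PolyEq f F' G') :
    PolyEq f (fun y => F y + F' y) fun y => G y + G' y := fun l => by
  simpa [add_sub_add_comm] using (h l).add (h' l)

theorem comp_right {Φ : E → E'} {F G : E' → E''} (h : PolyEq f' F G)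
    (hΦ : ∀ l : E' →L[ℝ] ℝ, (fun y => l (Φ y)) ∈ polyFun E)
    (hf : ∀ k, PolyVanish f fun y => f' k (Φ y)) :
    PolyEq f (fun y => F (Φ y)) fun y => G (Φ y) := fun l => (h l).comp hΦ hf

/-- Polynomial counterpart of Hadamard's lemma, by induction on `g`; products use `ab - a'b' = a(b -
b') + b'(a - a')`. -/
theorem polyVanish_sub {F G : E → E'} (h : PolyEq f F G)
    (hF : ∀ l : E' →L[ℝ] ℝ, (fun y => l (F y)) ∈ polyFun E)
    (hG : ∀ l : E' →L[ℝ] ℝ, (fun y => l (G y)) ∈ polyFun E) {g : E' → ℝ} (hg : g ∈ polyFun E') :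
    PolyVanish f fun y => g (F y) - g (G y) := by
  induction hg using Algebra.adjoin_induction with
  | mem g hg =>
    obtain ⟨l, rfl⟩ := hg
    exact h l
  | algebraMap r => simpa [Pi.algebraMap_apply] using PolyVanish.zero (f := f)
  | add g g' _ _ e e' => simpa [add_sub_add_comm] using e.add e'
  | mul g g' hg hg' e e' =>
    have e1 := (e'.mul_left (comp_mem_polyFun hg hF)).add
      (e.mul_left (comp_mem_polyFun hg' hG))
    convert e1 using 2 with y
    simp only [Pi.mul_apply]
    ring

theorem comp_left {F G : E → E'} {g : E' → E''} (h : PolyEq f F G)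
    (hF : ∀ l : E' →L[ℝ] ℝ, (fun y => l (F y)) ∈ polyFun E)
    (hG : ∀ l : E' →L[ℝ] ℝ, (fun y => l (G y)) ∈ polyFun E)
    (hg : ∀ l : E'' →L[ℝ] ℝ, (fun y => l (g y)) ∈ polyFun E') :
    PolyEq f (fun y => g (F y)) fun y => g (G y) :=
  fun l => h.polyVanish_sub hF hG (hg l)

end PolyEq

end Ideal

/-! ### Automorphisms, regular points and local triviality -/

section Automorphisms

variable {E E' E'' K : Type*} [NormedAddCommGroup E] [NormedSpace ℝ E]
  [NormedAddCommGroup E'] [NormedSpace ℝ E'] [NormedAddCommGroup E''] [NormedSpace ℝ E'']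
  [Fintype K] {f : K → E → ℝ} {C : Set E}

theorem IsAnAut.clm_comp (L : E' →L[ℝ] E'') {t : E → E'} {σ : C ≃ₜ C} (h : IsAnAut f C t σ) :
    IsAnAut f C (fun x => L (t x)) σ := by
  obtain ⟨F, G, hF, hG, h1, h2, h3⟩ := h
  exact ⟨F, G, hF, hG, h1, h2, fun x => (h3 x).clm_comp L⟩

/-- Automorphisms over `t` preserve the regular points of `t`. -/
theorem IsAnAut.isRegularPoint [FiniteDimensional ℝ E] [FiniteDimensional ℝ E'] {t : E →L[ℝ] E'}
    {σ : C ≃ₜ C} (h : IsAnAut f C t σ) (hC : ∀ x ∈ C, ∀ k, f k x = 0) {x : C}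
    (hx : IsRegularPoint f t (x : E)) : IsRegularPoint f t (σ x : E) := by
  obtain ⟨F, G, hF, hG, h1, h2, h3⟩ := h
  obtain ⟨s, s1, s2, s3, s4, s5⟩ := hx
  obtain ⟨a1, a2, a3, -⟩ := hF x
  obtain ⟨b1, b2, b3, -⟩ := hG (σ x)
  have h2' := h2 (σ x)
  rw [Homeomorph.symm_apply_apply] at h2' b2
  have ht : t (σ x : E) = t x := by
    rw [← a2]
    exact (h3 x).apply_eq (hC x x.2)
  -- The inverse lift is also over `t`: pull the relation `t ∘ F = t` back along `G` and use `F ∘ G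
  -- = id`.
  have tG : AnEq f (σ x : E) (fun y => t (G (σ x) y)) t := by
    have h4 := h3 x
    have h5 := AnEq.comp_right (Φ := G (σ x)) (x := (σ x : E)) (by rwa [b2]) b1 b3
    exact h5.symm.trans (h2'.clm_comp t)
  have hs2 : s (t x) = x := s2
  -- The local inverse at `σ x` is the one at `x` transported by the lift of `σ`.
  refine ⟨fun z => F x (s z), ?_, ?_, fun k => ?_, ?_, ?_⟩
  · rw [ht]
    exact AnalyticAt.fun_comp (by rwa [hs2]) s1
  · simp only [ht, hs2, a2]
  · rw [ht]
    exact (a3 k).eventually_comp_eq_zero s1.continuousAt s2 s3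
  · rw [ht]
    filter_upwards [(h3 x).eventually_comp_eq s1.continuousAt s2 s3, s4] with z e e'
    rw [e, e']
  -- Modulo the ideal, `F ∘ s ∘ t = F ∘ s ∘ t ∘ G = F ∘ G = id`.
  · have e1 : AnEq f (σ x : E) (fun y => s (t (G (σ x) y))) fun y => G (σ x) y :=
      AnEq.comp_right (Φ := G (σ x)) (F := fun y => s (t y)) (G := id) (by rwa [b2]) b1 b3
    have e2 : AnEq f (σ x : E) (fun y => s (t y)) fun y => s (t (G (σ x) y)) := by
      refine AnEq.comp_left tG.symm (t.analyticAt _) ((t.analyticAt _).comp b1) ?_ (by rwa [ht])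
      rw [b2, ht]
    have e3 := (e2.trans e1).comp_left (g := F x)
      (AnalyticAt.fun_comp (by rwa [ht]) (t.analyticAt _)) b1 (by rw [ht, hs2, b2])
      (by rwa [ht, hs2])
    exact e3.trans h2'

/-- A regular ramified covering is locally trivial over a point if all points above it are
regular. -/
theorem isLocallyTrivialAt_of_isRegularPoint [FiniteDimensional ℝ E] {t : E →L[ℝ] E'}
    (hC : ∀ x, x ∈ C ↔ ∀ k, f k x = 0) {G : Subgroup (C ≃ₜ C)}
    (hcov : IsRegularRamifiedCovering (fun x : C => t x) G) (x₀ : C)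
    (hreg : ∀ x ∈ C, t x = t x₀ → IsRegularPoint f t x) :
    IsLocallyTrivialAt f C t (t x₀) := by
  have hfin := hcov.finite
  have hG : ∀ g : G, t (g.1 x₀) = t x₀ := fun g => ((hcov.fiber_iff _ _).2 ⟨g, g.2, rfl⟩).symm
  -- The fibre is an orbit of a finite group, hence finite; this allows one neighbourhood to serve
  -- all sheets.
  let orb : G → {a : E // a ∈ C ∧ t a = t x₀} := fun g => ⟨g.1 x₀, (g.1 x₀).2, hG g⟩
  have horb : Function.Surjective orb := by
    rintro ⟨a, ha, hta⟩
    obtain ⟨g, hg, e⟩ := (hcov.fiber_iff x₀ ⟨a, ha⟩).1 hta.symm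
    exact ⟨⟨g, hg⟩, Subtype.ext (show (g x₀ : E) = a from congrArg Subtype.val e)⟩
  have hfinA : Finite {a : E // a ∈ C ∧ t a = t x₀} := Finite.of_surjective orb horb
  choose! s s1 s2 s3 s4 s5 using hreg
  have s1' : ∀ a : {a : E // a ∈ C ∧ t a = t x₀}, AnalyticAt ℝ (s a) (t x₀) := fun a => by
    simpa only [a.2.2] using s1 a a.2.1 a.2.2
  have s2' : ∀ a : {a : E // a ∈ C ∧ t a = t x₀}, s a (t x₀) = a := fun a => by
    simpa only [a.2.2] using s2 a a.2.1 a.2.2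
  have c1 : ∀ᶠ u in 𝓝 (t x₀), ∀ a : {a : E // a ∈ C ∧ t a = t x₀}, AnalyticAt ℝ (s a) u :=
    Filter.eventually_all.2 fun a => (s1' a).eventually_analyticAt
  have c2 : ∀ᶠ u in 𝓝 (t x₀), ∀ a : {a : E // a ∈ C ∧ t a = t x₀}, s a u ∈ C := by
    refine Filter.eventually_all.2 fun a => ?_
    have := Filter.eventually_all.2 (s3 a a.2.1 a.2.2)
    rw [a.2.2] at this
    filter_upwards [this] with u e
    exact (hC _).2 e
  have c3 : ∀ᶠ u in 𝓝 (t x₀), ∀ a : {a : E // a ∈ C ∧ t a = t x₀}, t (s a u) = u := by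
    refine Filter.eventually_all.2 fun a => ?_
    simpa only [a.2.2] using s4 a a.2.1 a.2.2
  have c4 : ∀ᶠ u in 𝓝 (t x₀), ∀ a : {a : E // a ∈ C ∧ t a = t x₀},
      AnEq f (s a u) (fun y => s a (t y)) id := by
    refine Filter.eventually_all.2 fun a => ?_
    have := (s5 a a.2.1 a.2.2).eventually
    have hlim := (s1' a).continuousAt.tendsto
    rw [s2' a] at hlim
    exact hlim.eventually this
  have c5 : ∀ᶠ u in 𝓝 (t x₀), ∀ a b : {a : E // a ∈ C ∧ t a = t x₀}, a ≠ b → s a u ≠ s b u := by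
    refine Filter.eventually_all.2 fun a => Filter.eventually_all.2 fun b => ?_
    by_cases hab : a = b
    · simp [hab]
    · have hne : s a (t x₀) ≠ s b (t x₀) := by
        rw [s2', s2']; exact fun h => hab (Subtype.ext h)
      filter_upwards [((s1' a).continuousAt.sub (s1' b).continuousAt).eventually_ne
        (sub_ne_zero.2 hne)] with u e _
      exact sub_ne_zero.1 e
  -- Near `x₀`, the symmetry `g` carries the sheet through `x₀` into the sheet through `g x₀`.
  have c6 : ∀ᶠ u in 𝓝 (t x₀), ∀ c : C, (c : E) = s x₀ u → ∀ g : G,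
      s (orb g) (t c) = g.1 c := by
    have hloc : ∀ g : G, ∀ᶠ c : C in 𝓝 x₀, s (orb g) (t c) = g.1 c := by
      intro g
      have h1 := (s5 (orb g) (orb g).2.1 (orb g).2.2).eventually_comp_eq
        (s := ((↑) : C → E)) (z := g.1 x₀) continuous_subtype_val.continuousAt rfl
        (fun k => .of_forall fun c => (hC c).1 c.2 k)
      filter_upwards [g.1.continuous.continuousAt.eventually h1] with c e
      have : t (g.1 c) = t c := ((hcov.fiber_iff _ _).2 ⟨g, g.2, rfl⟩).symm
      rw [← this]
      exact e
    have h2 := Filter.eventually_all.2 hloc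
    rw [nhds_subtype_eq_comap, Filter.eventually_comap] at h2
    have h3 : s x₀ (t x₀) = x₀ := s2' ⟨x₀, x₀.2, rfl⟩
    have hlim := (s1' ⟨x₀, x₀.2, rfl⟩).continuousAt.tendsto
    rw [h3] at hlim
    exact hlim.eventually h2
  obtain ⟨U, hU, hUo, hzU⟩ := eventually_nhds_iff.1
    (c1.and (c2.and (c3.and (c4.and (c5.and c6)))))
  refine ⟨U, fun a => s a, hUo, hzU, fun a => ⟨fun u hu => (hU u hu).1 a, s2' a⟩,
    fun a u hu => ⟨(hU u hu).2.1 a, (hU u hu).2.2.1 a⟩, fun x hx hxU => ?_,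
    fun a u hu => (hU u hu).2.2.2.1 a⟩
  obtain ⟨-, d2, d3, -, d5, d6⟩ := hU _ hxU
  -- No properness is needed to see that the sheets exhaust the preimage: `x` is a translate of the
  -- point of the sheet of `x₀` with the same image, so `c6` puts it on a sheet.
  have hm : s x₀ (t x) ∈ C := d2 ⟨x₀, x₀.2, rfl⟩
  have htm : t (s x₀ (t x)) = t x := d3 ⟨x₀, x₀.2, rfl⟩
  obtain ⟨g, hg, e⟩ := (hcov.fiber_iff ⟨_, hm⟩ ⟨x, hx⟩).1 htm
  refine ⟨orb ⟨g, hg⟩, ?_, fun b hb => ?_⟩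
  · have := d6 ⟨_, hm⟩ rfl ⟨g, hg⟩
    simp only [e] at this
    rwa [htm] at this
  · by_contra hne
    refine d5 _ _ hne (Eq.trans hb ?_)
    have := d6 ⟨_, hm⟩ rfl ⟨g, hg⟩
    simp only [e] at this
    rw [htm] at this
    exact this.symm

end Automorphisms

/-! ### Restriction of automorphisms and regular points to a linear slice -/

section Restriction

variable {E E₁ T T₁ K : Type*} [NormedAddCommGroup E] [NormedSpace ℝ E]
  [NormedAddCommGroup E₁] [NormedSpace ℝ E₁] [NormedAddCommGroup T] [NormedSpace ℝ T]
  [NormedAddCommGroup T₁] [NormedSpace ℝ T₁] [Fintype K]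

/-- A linear subspace of `E`, parametrized by `E₁` and defined by linear equations in the
value of `t`, together with the map `t₁` induced by `t`. -/
structure LinearSlice (t : E →L[ℝ] T) (t₁ : E₁ →L[ℝ] T₁) where
  /-- the parametrization -/
  incl : E₁ →L[ℝ] E
  /-- a retraction -/
  retr : E →L[ℝ] E₁
  /-- the equations of the subspace -/
  defect : T →L[ℝ] E
  /-- the projection inducing `t₁` -/
  proj : T →L[ℝ] T₁
  retr_incl : ∀ y, retr (incl y) = y
  defect_apply : ∀ x, defect (t x) = x - incl (retr x)
  proj_apply : ∀ y, proj (t (incl y)) = t₁ y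

namespace LinearSlice

variable {t : E →L[ℝ] T} {t₁ : E₁ →L[ℝ] T₁} (R : LinearSlice t t₁)
  {f : K → E → ℝ} {C : Set E}

theorem defect_incl (y : E₁) : R.defect (t (R.incl y)) = 0 := by
  rw [R.defect_apply, R.retr_incl, sub_self]

/-- The point of `C` with given parameter. -/
def point (x : R.incl ⁻¹' C) : C := ⟨R.incl x, x.2⟩

theorem continuous_point : Continuous (R.point : R.incl ⁻¹' C → C) :=
  (R.incl.continuous.comp continuous_subtype_val).subtype_mk _

/-- The distance of `F` from the slice is `defect (t F)`, congruent to `defect (t incl) = 0`. Hence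
a map with the right inputs factors through the slice modulo the ideal, even where its values leave
it. -/
theorem anEq_incl_retr {f₁ : K → E₁ → ℝ} {x : E₁} {F : E₁ → E}
    (h : AnEq f₁ x (fun y => t (F y)) fun y => t (R.incl y)) :
    AnEq f₁ x (fun y => R.incl (R.retr (F y))) F := by
  have h1 := (AnEq.refl F).add (h.clm_comp (-R.defect))
  simpa [R.defect_incl, R.defect_apply] using h1

theorem polyEq_incl_retr {f₁ : K → E₁ → ℝ} {F : E₁ → E}
    (h : PolyEq f₁ (fun y => t (F y)) fun y => t (R.incl y)) :
    PolyEq f₁ (fun y => R.incl (R.retr (F y))) F := by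
  have h1 := (PolyEq.refl F).add (h.clm_comp (-R.defect))
  simpa [R.defect_incl, R.defect_apply] using h1

theorem anVanish_incl {x : E₁} {g : E → ℝ} (h : AnVanish f (R.incl x) g) :
    AnVanish (fun k y => f k (R.incl y)) x fun y => g (R.incl y) := by
  obtain ⟨a, h1, h2⟩ := h
  exact ⟨fun k y => a k (R.incl y), fun k => (h1 k).comp (R.incl.analyticAt x),
    R.incl.continuous.continuousAt.eventually h2⟩

theorem anEq_incl {E' : Type*} [NormedAddCommGroup E'] [NormedSpace ℝ E'] {x : E₁} {F G : E → E'}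
    (h : AnEq f (R.incl x) F G) :
    AnEq (fun k y => f k (R.incl y)) x (fun y => F (R.incl y)) fun y => G (R.incl y) :=
  fun l => R.anVanish_incl (h l)

theorem polyVanish_incl {g : E → ℝ} (h : PolyVanish f g) :
    PolyVanish (fun k y => f k (R.incl y)) fun y => g (R.incl y) := by
  obtain ⟨a, h1, h2⟩ := h
  exact ⟨fun k y => a k (R.incl y),
    fun k => comp_mem_polyFun (h1 k) fun l => clm_mem_polyFun (l.comp R.incl), fun y => h2 _⟩

theorem polyEq_incl {E' : Type*} [NormedAddCommGroup E'] [NormedSpace ℝ E'] {F G : E → E'}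
    (h : PolyEq f F G) :
    PolyEq (fun k y => f k (R.incl y)) (fun y => F (R.incl y)) fun y => G (R.incl y) :=
  fun l => R.polyVanish_incl (h l)

variable [FiniteDimensional ℝ E]

/-- Away from real points `F` may leave the slice, so it is followed by the retraction; modulo the
ideal this changes nothing. -/
theorem isAnLift (hf : ∀ k x, AnalyticAt ℝ (f k) x) {σ : C → C}
    {σ₁ : R.incl ⁻¹' C → R.incl ⁻¹' C} (hσ : ∀ x, R.point (σ₁ x) = σ (R.point x))
    {F : C → E → E} (hF : IsAnLift f C σ F)
    (hFt : ∀ x : C, AnEq f (x : E) (fun y => t (F x y)) t) :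
    IsAnLift (fun k y => f k (R.incl y)) (R.incl ⁻¹' C) σ₁
      fun x y => R.retr (F (R.point x) (R.incl y)) := by
  intro x
  obtain ⟨a1, a2, a3, a4⟩ := hF (R.point x)
  have b1 : AnalyticAt ℝ (fun y => F (R.point x) (R.incl y)) (x : E₁) :=
    AnalyticAt.fun_comp (g := F (R.point x)) a1 (R.incl.analyticAt _)
  have b2 : R.incl (σ₁ x) = F (R.point x) (R.incl x) :=
    (congrArg Subtype.val (hσ x)).trans a2.symm
  have b3 : R.retr (F (R.point x) (R.incl x)) = σ₁ x := by
    rw [← b2, R.retr_incl]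
  refine ⟨(R.retr.analyticAt _).comp b1, b3, fun k => ?_, ?_⟩
  · have c1 := R.anEq_incl_retr (R.anEq_incl (F := fun y => t (F (R.point x) y)) (G := t)
      (hFt (R.point x)))
    have c2 := c1.comp_left (g := f k)
      ((R.incl.analyticAt _).comp ((R.retr.analyticAt _).comp b1)) b1
      (by rw [b3, b2]) (hf k _) (ContinuousLinearMap.id ℝ ℝ)
    have c3 := c2.add (R.anVanish_incl (a3 k))
    simpa using c3
  · filter_upwards [R.continuous_point.continuousAt.eventually a4] with y hy
    exact (R.anEq_incl (x := y) hy).clm_comp R.retr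

/-- The inner `incl ∘ retr` is the identity modulo the ideal, and `G` respects this congruence, so
inverse lifts remain inverse after restriction. -/
theorem anEq_comp_incl {x : R.incl ⁻¹' C} {x' : C} {F G : E → E} (hF : AnalyticAt ℝ F (R.incl x))
    (hFx : F (R.incl x) = x') (hx' : R.incl (R.retr x') = x') (hG : AnalyticAt ℝ G x')
    (hFt : AnEq f (R.incl x) (fun y => t (F y)) t)
    (h : AnEq f (R.incl x) (fun y => G (F y)) id) :
    AnEq (fun k y => f k (R.incl y)) (x : E₁)
      (fun y => R.retr (G (R.incl (R.retr (F (R.incl y)))))) id := by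
  have b1 : AnalyticAt ℝ (fun y => F (R.incl y)) (x : E₁) :=
    AnalyticAt.fun_comp (g := F) hF (R.incl.analyticAt _)
  have c1 := R.anEq_incl_retr (R.anEq_incl (F := fun y => t (F y)) (G := t) hFt)
  have c2 := c1.comp_left (g := G) ((R.incl.analyticAt _).comp ((R.retr.analyticAt _).comp b1)) b1
    (by rw [hFx, hx']) (by rwa [hFx, hx'])
  have c3 := (c2.trans (R.anEq_incl h)).clm_comp R.retr
  simpa [R.retr_incl, Function.id_def] using c3

/-- Restriction of analytic automorphisms over `t` to a linear slice. -/
theorem isAnAut (hf : ∀ k x, AnalyticAt ℝ (f k) x) {σ : C ≃ₜ C}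
    {σ₁ : R.incl ⁻¹' C ≃ₜ R.incl ⁻¹' C} (hσ : ∀ x, R.point (σ₁ x) = σ (R.point x))
    (h : IsAnAut f C t σ) :
    IsAnAut (fun k y => f k (R.incl y)) (R.incl ⁻¹' C) t₁ σ₁ := by
  have hσ' : ∀ x, R.point (σ₁.symm x) = σ.symm (R.point x) := fun x => by
    rw [Homeomorph.eq_symm_apply, ← hσ, Homeomorph.apply_symm_apply]
  have hpt : ∀ x : R.incl ⁻¹' C, R.incl (R.retr (R.point x)) = R.point x := fun x => by
    rw [point, R.retr_incl]
  obtain ⟨F, G, hF, hG, h1, h2, hFt⟩ := h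
  have hGt : ∀ x : C, AnEq f (x : E) (fun y => t (G x y)) t := by
    intro x
    obtain ⟨a1, a2, a3, -⟩ := hG x
    have h4 := hFt (σ.symm x)
    rw [← a2] at h4
    exact (h4.comp_right a1 a3).symm.trans ((h2 x).clm_comp t)
  refine ⟨_, _, R.isAnLift hf hσ hF hFt, R.isAnLift hf hσ' hG hGt, fun x => ?_, fun x => ?_,
    fun x => ?_⟩
  · obtain ⟨a1, a2, -, -⟩ := hF (R.point x)
    have b1 := (hG (σ (R.point x))).1
    rw [hσ x]
    exact R.anEq_comp_incl a1 a2 (by rw [← hσ, hpt]) b1 (hFt (R.point x)) (h1 (R.point x))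
  · obtain ⟨a1, a2, -, -⟩ := hG (R.point x)
    have b1 := (hF (σ.symm (R.point x))).1
    rw [hσ' x]
    exact R.anEq_comp_incl a1 a2 (by rw [← hσ', hpt]) b1 (hGt (R.point x)) (h2 (R.point x))
  · have c0 := R.anEq_incl (x := x) (hFt (R.point x))
    have c1 := ((R.anEq_incl_retr c0).clm_comp t).trans c0
    have c2 := c1.clm_comp R.proj
    simpa only [R.proj_apply] using c2

omit [FiniteDimensional ℝ E] in
theorem polyVanish_comp (hf : ∀ k, f k ∈ polyFun E) {F : E → E}
    (hF : ∀ l : E →L[ℝ] ℝ, (fun y => l (F y)) ∈ polyFun E)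
    (hFt : PolyEq f (fun y => t (F y)) t) (h : ∀ k, PolyVanish f fun y => f k (F y)) (k : K) :
    PolyVanish (fun k y => f k (R.incl y)) fun y => f k (R.incl (R.retr (F (R.incl y)))) := by
  have c1 := R.polyEq_incl_retr (R.polyEq_incl (F := fun y => t (F y)) (G := t) hFt)
  have c2 := c1.polyVanish_sub (fun l => comp_mem_polyFun (hF (l.comp (R.incl.comp R.retr)))
    fun l => clm_mem_polyFun (l.comp R.incl))
    (fun l => comp_mem_polyFun (hF l) fun l => clm_mem_polyFun (l.comp R.incl)) (hf k)
  simpa using c2.add (R.polyVanish_incl (h k))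

omit [FiniteDimensional ℝ E] in
theorem polyEq_comp {F G : E → E}
    (hF : ∀ l : E →L[ℝ] ℝ, (fun y => l (F y)) ∈ polyFun E)
    (hG : ∀ l : E →L[ℝ] ℝ, (fun y => l (G y)) ∈ polyFun E)
    (hFt : PolyEq f (fun y => t (F y)) t) (h : PolyEq f (fun y => G (F y)) id) :
    PolyEq (fun k y => f k (R.incl y))
      (fun y => R.retr (G (R.incl (R.retr (F (R.incl y)))))) id := by
  have c1 := R.polyEq_incl_retr (R.polyEq_incl (F := fun y => t (F y)) (G := t) hFt)
  have c2 := c1.comp_left (g := G) (fun l => comp_mem_polyFun (hF (l.comp (R.incl.comp R.retr)))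
    fun l => clm_mem_polyFun (l.comp R.incl))
    (fun l => comp_mem_polyFun (hF l) fun l => clm_mem_polyFun (l.comp R.incl)) hG
  have c3 := (c2.trans (R.polyEq_incl h)).clm_comp R.retr
  simpa [R.retr_incl, Function.id_def] using c3

omit [FiniteDimensional ℝ E] in
/-- Restriction of polynomial automorphisms over `t` to a linear slice. -/
theorem isPolyAut (hf : ∀ k, f k ∈ polyFun E) {σ : C ≃ₜ C}
    {σ₁ : R.incl ⁻¹' C ≃ₜ R.incl ⁻¹' C} (hσ : ∀ x, R.point (σ₁ x) = σ (R.point x))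
    (h : IsPolyAut f C t σ) :
    IsPolyAut (fun k y => f k (R.incl y)) (R.incl ⁻¹' C) t₁ σ₁ := by
  have hσ' : ∀ x, R.point (σ₁.symm x) = σ.symm (R.point x) := fun x => by
    rw [Homeomorph.eq_symm_apply, ← hσ, Homeomorph.apply_symm_apply]
  obtain ⟨F, G, hF, hG, h1, h2, h3, h4, h5, h6, hFt⟩ := h
  have hGt : PolyEq f (fun y => t (G y)) t :=
    (hFt.comp_right hG h4).symm.trans (h6.clm_comp t)
  refine ⟨fun y => R.retr (F (R.incl y)), fun y => R.retr (G (R.incl y)),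
    fun l => comp_mem_polyFun (hF (l.comp R.retr)) fun l => clm_mem_polyFun (l.comp R.incl),
    fun l => comp_mem_polyFun (hG (l.comp R.retr)) fun l => clm_mem_polyFun (l.comp R.incl),
    fun x => ?_, fun x => ?_, R.polyVanish_comp hf hF hFt h3, R.polyVanish_comp hf hG hGt h4,
    R.polyEq_comp hF hG hFt h5, R.polyEq_comp hG hF hGt h6, ?_⟩
  · have := h1 (R.point x)
    rw [← hσ] at this
    simp only [point] at this
    simp only [this, R.retr_incl]
  · have := h2 (R.point x)
    rw [← hσ'] at this
    simp only [point] at this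
    simp only [this, R.retr_incl]
  · have c0 := R.polyEq_incl hFt
    have c1 := ((R.polyEq_incl_retr c0).clm_comp t).trans c0
    simpa only [R.proj_apply] using c1.clm_comp R.proj

omit [FiniteDimensional ℝ E] in
/-- Restriction of regular points to a linear slice. -/
theorem isRegularPoint {M M₁ : Type*} [NormedAddCommGroup M] [NormedSpace ℝ M]
    [NormedAddCommGroup M₁] [NormedSpace ℝ M₁] {p : E →L[ℝ] M} {p₁ : E₁ →L[ℝ] M₁}
    (h : M₁ →L[ℝ] M) (hinj : Function.Injective h) (hp : ∀ y, p (R.incl y) = h (p₁ y))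
    (hR : ∀ x, (∀ k, f k x = 0) → ∀ z, p x = h z → R.incl (R.retr x) = x)
    {x : E₁} (hx : IsRegularPoint f p (R.incl x)) :
    IsRegularPoint (fun k y => f k (R.incl y)) p₁ x := by
  obtain ⟨s, s1, s2, s3, s4, s5⟩ := hx
  rw [hp] at s1 s2 s3 s4
  -- Over the image of `h` the local inverse already takes values in the slice, since these are real
  -- points with inputs in that image.
  have hs : ∀ᶠ z in 𝓝 (p₁ x), R.incl (R.retr (s (h z))) = s (h z) := by
    filter_upwards [h.continuous.continuousAt.eventually (Filter.eventually_all.2 s3),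
      h.continuous.continuousAt.eventually s4] with z e e'
    exact hR _ e _ e'
  refine ⟨fun z => R.retr (s (h z)),
    (R.retr.analyticAt _).comp (AnalyticAt.fun_comp (g := s) s1 (h.analyticAt _)), ?_, fun k => ?_,
    ?_, ?_⟩
  · simp only [s2, R.retr_incl]
  · filter_upwards [hs, h.continuous.continuousAt.eventually (s3 k)] with z e e'
    rw [e, e']
  · filter_upwards [hs, h.continuous.continuousAt.eventually s4] with z e e'
    apply hinj
    rw [← hp, e, e']
  · have c1 := (R.anEq_incl s5).clm_comp R.retr
    simpa [R.retr_incl, hp, Function.id_def] using c1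

end LinearSlice

end Restriction

/-! ### Restriction of a regular ramified covering to a linear slice -/

section Covering

variable {E E₁ T T₁ : Type*} [NormedAddCommGroup E] [NormedSpace ℝ E]
  [NormedAddCommGroup E₁] [NormedSpace ℝ E₁] [NormedAddCommGroup T] [NormedSpace ℝ T]
  [NormedAddCommGroup T₁] [NormedSpace ℝ T₁]

namespace LinearSlice

variable {t : E →L[ℝ] T} {t₁ : E₁ →L[ℝ] T₁} (R : LinearSlice t t₁) {C : Set E}

theorem point_injective : Function.Injective (R.point : R.incl ⁻¹' C → C) := by
  intro x y h
  have h1 := congrArg R.retr (congrArg Subtype.val h)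
  simp only [point, R.retr_incl] at h1
  exact Subtype.ext h1

theorem incl_retr_point (x : R.incl ⁻¹' C) : R.incl (R.retr (R.point x)) = R.point x := by
  simp only [point, R.retr_incl]

theorem exists_point_eq {c : C} (hc : R.incl (R.retr c) = c) : ∃ x, R.point x = c :=
  ⟨⟨R.retr c, by rw [Set.mem_preimage, hc]; exact c.2⟩, Subtype.ext hc⟩

/-- The image is the fixed locus of `incl ∘ retr`, a closed condition, and `retr` is a continuous
inverse on it. -/
theorem isClosedMap_point : IsClosedMap (R.point : R.incl ⁻¹' C → C) := by
  intro K hK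
  obtain ⟨K', hK', rfl⟩ := isClosed_induced_iff.1 hK
  have : R.point '' (Subtype.val ⁻¹' K') =
      {c : C | R.incl (R.retr c) = c} ∩ {c : C | R.retr c ∈ K'} := by
    ext c
    constructor
    · rintro ⟨x, hx, rfl⟩
      exact ⟨R.incl_retr_point x, by simpa [point, R.retr_incl] using hx⟩
    · rintro ⟨h1, h2⟩
      obtain ⟨x, rfl⟩ := R.exists_point_eq h1
      exact ⟨x, by simpa [point, R.retr_incl] using h2, rfl⟩
  rw [this]
  exact (isClosed_eq (R.incl.continuous.comp (R.retr.continuous.comp continuous_subtype_val))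
    continuous_subtype_val).inter (hK'.preimage (R.retr.continuous.comp continuous_subtype_val))

/-- Membership in the slice depends only on the value of `t`, so homeomorphisms over `t` preserve
the slice. -/
theorem incl_retr_of_eq {x : E} {y : E₁} (h : t x = t (R.incl y)) : R.incl (R.retr x) = x := by
  have h1 := R.defect_apply x
  rw [h, R.defect_incl] at h1
  exact (sub_eq_zero.1 h1.symm).symm

theorem incl_retr_apply_point {σ : C ≃ₜ C} (hσ : ∀ x : C, t (σ x) = t x) (x : R.incl ⁻¹' C) :
    R.incl (R.retr (σ (R.point x))) = σ (R.point x) :=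
  R.incl_retr_of_eq (hσ (R.point x))

/-- Restriction of a homeomorphism over `t`, as a map. -/
def restrictFun (σ : C ≃ₜ C) (hσ : ∀ x : C, t (σ x) = t x) (x : R.incl ⁻¹' C) : R.incl ⁻¹' C :=
  ⟨R.retr (σ (R.point x)), by
    rw [Set.mem_preimage, R.incl_retr_apply_point hσ]
    exact Subtype.coe_prop _⟩

theorem point_restrictFun (σ : C ≃ₜ C) (hσ : ∀ x : C, t (σ x) = t x) (x : R.incl ⁻¹' C) :
    R.point (R.restrictFun σ hσ x) = σ (R.point x) :=
  Subtype.ext (R.incl_retr_apply_point hσ x)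

theorem continuous_restrictFun (σ : C ≃ₜ C) (hσ : ∀ x : C, t (σ x) = t x) :
    Continuous (R.restrictFun σ hσ) :=
  (R.retr.continuous.comp (continuous_subtype_val.comp
    (σ.continuous.comp R.continuous_point))).subtype_mk _

/-- Restriction of homeomorphisms over `t`. -/
def restrict (G : Subgroup (C ≃ₜ C)) (hG : ∀ σ ∈ G, ∀ x : C, t (σ x) = t x) :
    G →* (R.incl ⁻¹' C ≃ₜ R.incl ⁻¹' C) where
  toFun σ :=
    { toFun := R.restrictFun σ.1 (hG σ σ.2)
      invFun := R.restrictFun σ.1⁻¹ (hG _ (inv_mem σ.2))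
      left_inv := fun x => R.point_injective (by simp [point_restrictFun])
      right_inv := fun x => R.point_injective (by simp [point_restrictFun])
      continuous_toFun := R.continuous_restrictFun _ _
      continuous_invFun := R.continuous_restrictFun _ _ }
  map_one' := Homeomorph.ext fun x => R.point_injective <|
    R.point_restrictFun _ (hG _ (1 : G).2) x
  map_mul' σ τ := Homeomorph.ext fun x => R.point_injective <| by
    refine (R.point_restrictFun _ (hG _ (σ * τ).2) x).trans ?_
    refine Eq.trans ?_ (R.point_restrictFun _ (hG _ σ.2) _).symm
    exact congrArg σ.1 (R.point_restrictFun _ (hG _ τ.2) x).symm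

theorem point_restrict (G : Subgroup (C ≃ₜ C)) (hG : ∀ σ ∈ G, ∀ x : C, t (σ x) = t x) (σ : G)
    (x : R.incl ⁻¹' C) : R.point (R.restrict G hG σ x) = σ.1 (R.point x) :=
  R.point_restrictFun _ (hG _ σ.2) x

/-- Restriction of a regular ramified covering to a linear slice. -/
theorem isRegularRamifiedCovering {M M₁ : Type*} [TopologicalSpace M] [TopologicalSpace M₁]
    {p : E → M} {p₁ : E₁ → M₁} {h : M₁ → M} (hinj : Function.Injective h) (hh : Continuous h)
    (hp₁ : Continuous p₁) (hp : ∀ y, p (R.incl y) = h (p₁ y))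
    (hR : ∀ x ∈ C, ∀ z, p x = h z → R.incl (R.retr x) = x)
    {G : Subgroup (C ≃ₜ C)} (hG : ∀ σ ∈ G, ∀ x : C, t (σ x) = t x)
    (hcov : IsRegularRamifiedCovering (fun x : C => p x) G) :
    IsRegularRamifiedCovering (fun x : R.incl ⁻¹' C => p₁ x) (R.restrict G hG).range := by
  have hpt : ∀ x : R.incl ⁻¹' C, p (R.point x) = h (p₁ x) := fun x => hp x
  have hfin := hcov.finite
  refine ⟨.of_surjective _ (R.restrict G hG).rangeRestrict_surjective, isQuotientMap_iff_isClosed.2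
    ⟨Set.rangeFactorization_surjective, fun s => ⟨fun hs => hs.preimage
      ((hp₁.comp continuous_subtype_val).subtype_mk _), fun hs => ?_⟩⟩, fun x y => ?_⟩
  · let h' : Set.range (fun x : R.incl ⁻¹' C => p₁ x) → Set.range (fun x : C => p x) :=
      fun z => ⟨h z, by
        obtain ⟨_, x, rfl⟩ := z
        exact ⟨R.point x, hpt x⟩⟩
    have hh' : Continuous h' := (hh.comp continuous_subtype_val).subtype_mk _
    have hK := R.isClosedMap_point _ hs
    -- Fibres of `p` meeting the slice stay in it, so the closed set pushed into `C` is saturated.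
    -- Its image is then closed by the quotient property of `p`, and `s` is the preimage of that
    -- image under `h'`.
    have hcl : IsClosed (Set.rangeFactorization (fun x : C => p x) ''
        (R.point '' (Set.rangeFactorization (fun x : R.incl ⁻¹' C => p₁ x) ⁻¹' s))) := by
      rw [← hcov.isQuotientMap.isClosed_preimage]
      convert hK using 1
      refine Set.Subset.antisymm ?_ (Set.subset_preimage_image _ _)
      rintro c ⟨_, ⟨x, hx, rfl⟩, e⟩
      have e' : p (R.point x) = p c := congrArg Subtype.val e
      obtain ⟨y, rfl⟩ := R.exists_point_eq (hR c c.2 (p₁ x) (by rw [← e', hpt]))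
      refine ⟨y, ?_, rfl⟩
      rw [hpt, hpt] at e'
      have e'' : Set.rangeFactorization (fun x : R.incl ⁻¹' C => p₁ x) y =
          Set.rangeFactorization (fun x : R.incl ⁻¹' C => p₁ x) x := Subtype.ext (hinj e').symm
      rw [Set.mem_preimage, e'']
      exact hx
    convert hcl.preimage hh' using 1
    ext z
    obtain ⟨x, rfl⟩ := Set.rangeFactorization_surjective z
    constructor
    · intro hz
      exact ⟨R.point x, ⟨x, hz, rfl⟩, Subtype.ext (hpt x)⟩
    · rintro ⟨_, ⟨y, hy, rfl⟩, e⟩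
      have e' : p (R.point y) = h (p₁ x) := congrArg Subtype.val e
      rw [hpt] at e'
      have e'' : Set.rangeFactorization (fun x : R.incl ⁻¹' C => p₁ x) y =
          Set.rangeFactorization (fun x : R.incl ⁻¹' C => p₁ x) x := Subtype.ext (hinj e')
      rw [Set.mem_preimage, e''] at hy
      exact hy
  · rw [← hinj.eq_iff, ← hpt, ← hpt, hcov.fiber_iff]
    constructor
    · rintro ⟨g, hg, e⟩
      exact ⟨_, ⟨⟨g, hg⟩, rfl⟩, R.point_injective ((R.point_restrict G hG ⟨g, hg⟩ x).trans e)⟩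
    · rintro ⟨_, ⟨g, rfl⟩, rfl⟩
      exact ⟨g, g.2, (R.point_restrict G hG g x).symm⟩

end LinearSlice
end Covering

open MarkedLinkage

/-! ### The glued linkage as a linear slice -/

section Glue

variable {V E S D ι : Type*}

/-- A section of the projection to the glued vertex set. -/
def Glued.rep {V : Type*} (v w : V) : Glued v w → V := by
  classical
  exact Quot.lift (fun u => if u = w then v else u) (by rintro a b ⟨rfl, rfl⟩; simp)

theorem Glued.mk_eq {V : Type*} (v w : V) : Glued.mk v w v = Glued.mk v w w :=
  Quot.sound ⟨rfl, rfl⟩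

theorem Glued.mk_rep {V : Type*} (v w : V) (q : Glued v w) : Glued.mk v w (Glued.rep v w q) = q := by
  obtain ⟨u, rfl⟩ := Quot.exists_rep q
  simp only [Glued.rep]
  split_ifs with h
  · subst h; exact Glued.mk_eq _ _
  · rfl


/-- The positions of the input vertices, as a continuous linear map. -/
def inputPosL (P : ι → V) : (V → ℂ) →L[ℝ] (ι → ℂ) :=
  ContinuousLinearMap.pi fun i => ContinuousLinearMap.proj (P i)

/-- The input map, as a continuous linear map. -/
def inputMapL (𝕜 : Type*) [RCLike 𝕜] (P : ι → V) : (V → ℂ) →L[ℝ] (ι → 𝕜) :=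
  ContinuousLinearMap.pi fun i => (RCLike.map ℂ 𝕜).comp (ContinuousLinearMap.proj (P i))

/-- The parametrization of the hyperplane, as a continuous linear map. -/
def hyperplaneParamL (𝕜 : Type*) [RCLike 𝕜] [DecidableEq ι] {i j : ι} (hij : i ≠ j) :
    ({k : ι // k ≠ j} → 𝕜) →L[ℝ] (ι → 𝕜) :=
  ContinuousLinearMap.pi fun k =>
    if h : k = j then ContinuousLinearMap.proj ⟨i, hij⟩ else ContinuousLinearMap.proj ⟨k, h⟩

theorem hyperplaneParamL_apply {𝕜 : Type*} [RCLike 𝕜] [DecidableEq ι] {i j : ι} (hij : i ≠ j) :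
    ⇑(hyperplaneParamL 𝕜 hij) = hyperplaneParam hij := by
  funext y k
  simp only [hyperplaneParamL, hyperplaneParam, ContinuousLinearMap.pi_apply]
  split_ifs <;> rfl

variable [Fintype V] [Fintype ι] [DecidableEq ι]

open Classical in
/-- The realizations of the glued linkage, as a linear slice of the realizations. -/
def glueSlice (P : ι → V) (i j : ι) :
    LinearSlice (inputPosL P)
      (inputPosL fun k : {k : ι // k ≠ j} => Glued.mk (P i) (P j) (P k)) where
  incl := ContinuousLinearMap.pi fun u => ContinuousLinearMap.proj (Glued.mk (P i) (P j) u)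
  retr := ContinuousLinearMap.pi fun q => ContinuousLinearMap.proj (Glued.rep (P i) (P j) q)
  -- The defect is `x(w) - x(v)` at `w` and zero elsewhere. It is a function of the inputs precisely
  -- because both glued vertices are inputs.
  defect := ContinuousLinearMap.pi fun u =>
    if u = P j then ContinuousLinearMap.proj j - ContinuousLinearMap.proj i else 0
  proj := ContinuousLinearMap.pi fun k => ContinuousLinearMap.proj (k : ι)
  retr_incl y := by
    funext q
    exact congrArg y (Glued.mk_rep _ _ q)
  defect_apply x := by
    funext u
    let δ : (ι → ℂ) →L[ℝ] ℂ :=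
      (ContinuousLinearMap.proj j : (ι → ℂ) →L[ℝ] ℂ) - ContinuousLinearMap.proj i
    change (if u = P j then δ else 0) (inputPosL P x) = x u - x (if u = P j then P i else u)
    split_ifs with h
    · rw [h]; rfl
    · simp
  proj_apply _ := rfl

theorem equations_mem_polyFun (A : MarkedLinkage V E S D) (Z : S → ℂ) (k : E ⊕ (S × Bool) ⊕ (D × Bool)) :
    A.equations Z k ∈ polyFun (V → ℂ) := by
  have hre : ∀ L : (V → ℂ) →L[ℝ] ℂ, (fun φ => (L φ).re) ∈ polyFun (V → ℂ) := fun L =>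
    clm_mem_polyFun (Complex.reCLM.comp L)
  have him : ∀ L : (V → ℂ) →L[ℝ] ℂ, (fun φ => (L φ).im) ∈ polyFun (V → ℂ) := fun L =>
    clm_mem_polyFun (Complex.imCLM.comp L)
  obtain e | ⟨s, b⟩ | ⟨d, b⟩ := k
  · simp only [equations]
    split_ifs
    · exact const_mem_polyFun 0
    · let L : (V → ℂ) →L[ℝ] ℂ :=
        (ContinuousLinearMap.proj (A.src e) : (V → ℂ) →L[ℝ] ℂ) - ContinuousLinearMap.proj (A.tgt e)
      have h := sub_mem (add_mem (mul_mem (hre L) (hre L)) (mul_mem (him L) (him L)))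
        (const_mem_polyFun (E := V → ℂ) (A.len e ^ 2))
      convert h using 1
      funext φ
      simp only [Complex.sq_norm, Complex.normSq_apply]
      rfl
  · let L : (V → ℂ) →L[ℝ] ℂ := ContinuousLinearMap.proj (A.mark s)
    cases b
    · exact sub_mem (hre L) (const_mem_polyFun (Z s).re)
    · exact sub_mem (him L) (const_mem_polyFun (Z s).im)
  · let L : (V → ℂ) →L[ℝ] ℂ := ContinuousLinearMap.proj (A.triB d) -
      ((A.len (A.edgeBC d) / A.len (A.edgeAC d) : ℝ) • ContinuousLinearMap.proj (A.triA d) +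
        (A.len (A.edgeAB d) / A.len (A.edgeAC d) : ℝ) • ContinuousLinearMap.proj (A.triC d))
    have hL : ∀ φ, L φ = φ (A.triB d) -
        (((A.len (A.edgeBC d) / A.len (A.edgeAC d) : ℝ) : ℂ) * φ (A.triA d) +
          ((A.len (A.edgeAB d) / A.len (A.edgeAC d) : ℝ) : ℂ) * φ (A.triC d)) := fun φ => by
      simp [L]
    cases b
    · have := hre L
      simp only [hL] at this
      exact this
    · have := him L
      simp only [hL] at this
      exact this

/-- Gluing keeps edges, marks and listed triangles, so the equations agree one by one and not merely
their zero sets. -/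
theorem glue_equations (A : MarkedLinkage V E S D) (Z : S → ℂ) (P : ι → V) (i j : ι) :
    (A.glue (P i) (P j)).equations Z =
      fun k y => A.equations Z k ((glueSlice P i j).incl y) := by
  funext k y
  obtain e | ⟨s, b⟩ | ⟨d, b⟩ := k <;> rfl

open Classical in
theorem glueSlice_incl_retr (P : ι → V) {i j : ι} {x : V → ℂ} (hx : x (P i) = x (P j)) :
    (glueSlice P i j).incl ((glueSlice P i j).retr x) = x := by
  funext u
  change x (if u = P j then P i else u) = x u
  split_ifs with h
  · rw [h, hx]
  · rfl

end Glue


open MarkedLinkage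

theorem hyperplaneParam_injective {ι 𝕜 : Type*} [DecidableEq ι] {i j : ι} (hij : i ≠ j) :
    Function.Injective (hyperplaneParam (𝕜 := 𝕜) hij) := by
  intro y z h
  funext k
  have := congrFun h k
  simpa [hyperplaneParam, k.2] using this

theorem hyperplaneParam_apply_eq {ι 𝕜 : Type*} [DecidableEq ι] {i j : ι} (hij : i ≠ j)
    (y : {k : ι // k ≠ j} → 𝕜) : hyperplaneParam hij y i = hyperplaneParam hij y j := by
  simp [hyperplaneParam, hij]

theorem hyperplaneParam_restrict {ι 𝕜 : Type*} [DecidableEq ι] {i j : ι} (hij : i ≠ j)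
    {x : ι → 𝕜} (hx : x i = x j) : hyperplaneParam hij (fun k : {k : ι // k ≠ j} => x k) = x := by
  funext k
  by_cases h : k = j
  · subst h; simpa [hyperplaneParam] using hx
  · simp [hyperplaneParam, h]

end Linkages

end

/-! ### The functionality theorem -/

open Linkages MarkedLinkage in
theorem mainTheorem8 {𝕜 : Type*} [RCLike 𝕜] {V E S D ι κ : Type*}
    [Fintype V] [Fintype E] [Fintype S] [Fintype D] [Fintype ι] [DecidableEq ι]
    (A : MarkedLinkage V E S D) (Z : S → ℂ) (P : ι → V) (Q : κ → V)
    (f : (ι → 𝕜) → κ → 𝕜) (SymA : Subgroup (A.config Z ≃ₜ A.config Z))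
    (hA : A.IsFunctional Z P Q f (A.domStar 𝕜 Z P) SymA)
    {i j : ι} (hij : i ≠ j)
    (hne : {x ∈ A.domStar 𝕜 Z P | x i = x j}.Nonempty) :
    let L := A.glue (P i) (P j)
    let P' : {k : ι // k ≠ j} → Glued (P i) (P j) := fun k => Glued.mk (P i) (P j) (P k)
    let Q' : κ → Glued (P i) (P j) := fun k => Glued.mk (P i) (P j) (Q k)
    let h : ({k : ι // k ≠ j} → 𝕜) → ι → 𝕜 := hyperplaneParam hij
    ∃ (SymL : Subgroup (L.config Z ≃ₜ L.config Z)) (e : SymA ≃* SymL),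
      -- the isomorphism of symmetry groups is the restriction of symmetries
      (∀ (σ : SymA) (φ : L.config Z),
        A.unglue Z (P i) (P j) ((e σ : L.config Z ≃ₜ L.config Z) φ) =
          (σ : A.config Z ≃ₜ A.config Z) (A.unglue Z (P i) (P j) φ)) ∧
      (∀ σ : SymA, IsPolyAut (A.equations Z) (A.config Z) (inputPos P) σ →
        IsPolyAut (L.equations Z) (L.config Z) (inputPos P') (e σ)) ∧
      -- the input map is a regular ramified covering
      IsRegularRamifiedCovering (fun φ : L.config Z => inputMap 𝕜 P' (φ : _ → ℂ)) SymL ∧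
      -- it is locally analytically trivial over the set of regular values
      (∀ y ∈ L.domStar 𝕜 Z P',
        IsLocallyTrivialAt (L.equations Z) (L.config Z) (inputMap 𝕜 P') y) ∧
      L.dom 𝕜 Z P' ∩ h ⁻¹' A.domStar 𝕜 Z P ⊆ L.domStar 𝕜 Z P' ∧
      -- the domain
      IsPolyIso (L.dom 𝕜 Z P') {x ∈ A.dom 𝕜 Z P | x i = x j} h ∧
      -- functionality
      L.IsFunctional Z P' Q' (fun y => f (h y)) (L.dom 𝕜 Z P' ∩ h ⁻¹' A.domStar 𝕜 Z P) SymL := by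
  intro L P' Q' h
  -- The set `L.config Z` is definitionally `R.incl ⁻¹' A.config Z`, so the slice lemmas apply to it
  -- directly.
  let R := glueSlice P i j
  have hp : ∀ y, inputMapL 𝕜 P (R.incl y) = h (inputMapL 𝕜 P' y) := by
    intro y
    refine (hyperplaneParam_restrict hij ?_).symm
    exact congrArg (fun q => RCLike.map ℂ 𝕜 (y q)) (Glued.mk_eq (P i) (P j))
  have hhL : ⇑(hyperplaneParamL 𝕜 hij) = h := hyperplaneParamL_apply hij
  have hhc : Continuous h := hhL ▸ (hyperplaneParamL 𝕜 hij).continuous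
  have hinj : Function.Injective h := hyperplaneParam_injective hij
  -- For `𝕜 = ℝ` the input map forgets imaginary parts; `input_mem` is what turns equal inputs into
  -- equal positions in the plane.
  have heq : ∀ x ∈ A.config Z, inputMap 𝕜 P x i = inputMap 𝕜 P x j →
      R.incl (R.retr x) = x := by
    intro x hx hxij
    refine glueSlice_incl_retr P ?_
    rw [← hA.input_mem x hx i, ← hA.input_mem x hx j, hxij]
  have hR : ∀ x ∈ A.config Z, ∀ z, inputMapL 𝕜 P x = h z → R.incl (R.retr x) = x := by
    intro x hx z hz
    refine heq x hx ?_
    change inputMapL 𝕜 P x i = inputMapL 𝕜 P x j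
    rw [hz]
    exact hyperplaneParam_apply_eq hij z
  have hG : ∀ σ ∈ SymA, ∀ x : A.config Z, inputPosL P (σ x) = inputPosL P x := by
    intro σ hσ x
    have h1 : inputMap 𝕜 P (x : V → ℂ) = inputMap 𝕜 P (σ x : V → ℂ) :=
      (hA.covering.fiber_iff x (σ x)).2 ⟨σ, hσ, rfl⟩
    funext k
    change (σ x : V → ℂ) (P k) = (x : V → ℂ) (P k)
    rw [← hA.input_mem _ (σ x).2 k, ← hA.input_mem _ x.2 k, h1]
  have hpt := R.point_restrict SymA hG
  have hLeq : L.equations Z = fun k y => A.equations Z k (R.incl y) := glue_equations A Z P i j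
  have hLdom : L.dom 𝕜 Z P' = h ⁻¹' A.dom 𝕜 Z P := by
    ext z
    constructor
    · rintro ⟨y, hy, rfl⟩
      exact ⟨R.incl y, hy, hp y⟩
    · rintro ⟨x, hx, hxz⟩
      have hx' := hR x hx z hxz
      refine ⟨R.retr x, ?_, hinj ?_⟩
      · change R.incl (R.retr x) ∈ A.config Z
        rwa [hx']
      · exact (hp (R.retr x)).symm.trans ((congrArg (inputMapL 𝕜 P) hx').trans hxz)
  have hstar : A.domStar 𝕜 Z P ⊆ A.dom 𝕜 Z P := Set.image_mono fun _ hx => hx.1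
  have hU : L.dom 𝕜 Z P' ∩ h ⁻¹' A.domStar 𝕜 Z P = h ⁻¹' A.domStar 𝕜 Z P := by
    rw [hLdom]
    exact Set.inter_eq_right.2 (Set.preimage_mono hstar)
  have hUopen : IsOpen (h ⁻¹' A.domStar 𝕜 Z P) := hA.isOpen.preimage hhc
  have hUne : (h ⁻¹' A.domStar 𝕜 Z P).Nonempty := by
    obtain ⟨x, hx, hxij⟩ := hne
    exact ⟨fun k => x k, Set.mem_preimage.2 (Set.mem_of_eq_of_mem (hyperplaneParam_restrict hij hxij) hx)⟩
  have hunram : ∀ σ : SymA, ∀ φ : L.config Z, inputMap 𝕜 P' (φ : _ → ℂ) ∈ h ⁻¹' A.domStar 𝕜 Z P →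
      R.restrict SymA hG σ φ = φ → σ = 1 := by
    intro σ φ hφ hσ
    refine Subtype.ext (hA.unramified σ σ.2 (R.point φ) ?_ ?_)
    · have := hp (φ : _ → ℂ)
      exact Set.mem_of_eq_of_mem this hφ
    · exact (hpt σ φ).symm.trans (congrArg R.point hσ)
  -- A symmetry that is trivial on the slice fixes a point over `Dom*(A)`, which exists because the
  -- hyperplane meets that set.
  have hinjR : Function.Injective (R.restrict SymA hG) := by
    rw [injective_iff_map_eq_one]
    intro σ hσ
    obtain ⟨z, hz⟩ := hUne
    obtain ⟨φ, hφ, rfl⟩ : z ∈ L.dom 𝕜 Z P' := hLdom ▸ hstar hz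
    exact hunram σ ⟨φ, hφ⟩ hz (by rw [hσ]; rfl)
  have hcov : IsRegularRamifiedCovering (fun φ : L.config Z => inputMap 𝕜 P' (φ : _ → ℂ))
      (R.restrict SymA hG).range :=
    R.isRegularRamifiedCovering hinj hhc (inputMapL 𝕜 P').continuous hp hR hG hA.covering
  have haut : ∀ σ ∈ (R.restrict SymA hG).range,
      IsAnAut (L.equations Z) (L.config Z) (inputPosL P') σ := by
    rintro _ ⟨σ, rfl⟩
    rw [hLeq]
    exact R.isAnAut (fun k => analyticAt_of_mem_polyFun (equations_mem_polyFun A Z k)) (hpt σ)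
      (hA.isAnAut σ σ.2)
  have hzero : ∀ x, x ∈ L.config Z ↔ ∀ k, L.equations Z k x = 0 := L.mem_config_iff Z
  have hsub : h ⁻¹' A.domStar 𝕜 Z P ⊆ L.domStar 𝕜 Z P' := by
    rintro z ⟨x, ⟨hx, hreg⟩, hxz⟩
    have hx' := hR x hx z hxz
    have hreg' : IsRegularPoint (A.equations Z) (inputMapL 𝕜 P) (R.incl (R.retr x)) := by
      rw [hx']; exact hreg
    refine ⟨R.retr x, ⟨?_, ?_⟩, hinj ?_⟩
    · change R.incl (R.retr x) ∈ A.config Z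
      rwa [hx']
    · rw [hLeq]
      exact R.isRegularPoint (p₁ := inputMapL 𝕜 P') (hyperplaneParamL 𝕜 hij) (hhL ▸ hinj)
        (hhL ▸ hp) (fun x hx z hz => hR x ((A.mem_config_iff Z x).2 hx) z (hhL ▸ hz)) hreg'
    · exact (hp (R.retr x)).symm.trans ((congrArg (inputMapL 𝕜 P) hx').trans hxz)
  refine ⟨(R.restrict SymA hG).range, MonoidHom.ofInjective hinjR, fun σ φ => hpt σ φ, ?_, hcov,
    ?_, hU.subset.trans hsub, ?_, ?_⟩
  · intro σ hσ
    rw [hLeq]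
    exact R.isPolyAut (equations_mem_polyFun A Z) (hpt σ) hσ
  · rintro _ ⟨φ, ⟨hφ, hreg⟩, rfl⟩
    refine isLocallyTrivialAt_of_isRegularPoint (t := inputMapL 𝕜 P') hzero hcov ⟨φ, hφ⟩ ?_
    intro x hx hxφ
    -- Regularity spreads from `φ` to every point of its fibre through the transitive symmetries.
    -- These are automorphisms over the planar positions, hence over the `𝕜`-valued inputs after a
    -- linear map.
    obtain ⟨g, hg, hgx⟩ := (hcov.fiber_iff ⟨φ, hφ⟩ ⟨x, hx⟩).1 hxφ.symm
    have h1 := ((haut g hg).clm_comp (ContinuousLinearMap.pi fun k =>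
      (RCLike.map ℂ 𝕜).comp (ContinuousLinearMap.proj k)))
    have h2 := IsAnAut.isRegularPoint (t := inputMapL 𝕜 P') h1 (fun x hx => (hzero x).1 hx)
      (x := ⟨φ, hφ⟩) hreg
    exact (congrArg (IsRegularPoint (L.equations Z) (inputMapL 𝕜 P'))
      (congrArg Subtype.val hgx)).mp h2
  -- The inverse forgets the `j`-th coordinate.
  · refine ⟨fun x k => x k, fun l => ?_, fun l => ?_, fun z hz => ⟨⟨?_, ?_⟩, ?_⟩,
      fun x hx => ⟨?_, ?_⟩⟩
    · rw [← hhL]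
      exact clm_mem_polyFun (l.comp (hyperplaneParamL 𝕜 hij))
    · exact clm_mem_polyFun (l.comp (ContinuousLinearMap.pi fun k : {k : ι // k ≠ j} =>
        (ContinuousLinearMap.proj (k : ι) : (ι → 𝕜) →L[ℝ] 𝕜)))
    · rw [hLdom] at hz
      exact hz
    · exact hyperplaneParam_apply_eq hij z
    · funext k
      simp [h, hyperplaneParam, k.2]
    · rw [hLdom]
      exact Set.mem_preimage.2 (Set.mem_of_eq_of_mem (hyperplaneParam_restrict hij hx.2) hx.1)
    · exact hyperplaneParam_restrict hij hx.2
  · rw [hU]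
    refine ⟨fun φ hφ k => hA.input_mem (R.incl φ) hφ k, ?_, hcov, haut, hUopen, hUne, hsub, ?_, ?_⟩
    · rw [hLdom]
      -- The interior of the new domain contains the trace of `Dom*(A)` on the hyperplane, which is
      -- open and nonempty.
      exact hUne.mono (interior_maximal (Set.preimage_mono hstar) hUopen)
    · rintro _ ⟨σ, rfl⟩ φ hφ hσ
      rw [hunram σ φ hφ hσ]
      exact map_one (R.restrict SymA hG)
    · intro φ hφ k
      have h1 := hA.output (R.incl φ) hφ k
      have h2 : inputMap 𝕜 P (R.incl φ) = h (inputMap 𝕜 P' φ) := hp φ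
      rw [h2] at h1
      exact h1
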